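/- Let $M$ be a smooth $n$-manifold with a pseudo-Riemannian metric $g$, let $\varepsilon>0$, and let $g_\rho$, $\rho\in(-\varepsilon,\varepsilon)$, be a smooth one-parameter family of pseudo-Riemannian metrics on $M$ with $g_0=g$. On $\widetilde{\mathcal G}=\{(t,x,\rho): t>0,\ x\in M,\ |\rho|<\varepsilon\}$ consider the straight and normal metric $$\widetilde g = 2\rho\,dt^2+2t\,dt\,d\rho+t^2g_\rho ,$$ for instance the straight and normal ambient metric of $(M,g)$ (formal Ricci flatness is not needed). Put $r=\sqrt{-2\rho}$ and $s=rt$ where $\rho<0$, so that $\widetilde g=-ds^2+s^2g_+$ with $g_+=r^{-2}(dr^2+g_{-r^2/2})$. The Poincaré space is the hypersurface $\mathring X=\{s=1\}=\{\widetilde g(t\partial_t,t\partial_t)=-1\}$ with the metric $g_+$; in the coordinates $(r,x)$, $0<r<\sqrt{2\varepsilon}$, it is included by $(r,x)\mapsto(t,x,\rho)=(1/r,x,-r^2/2)$. Let $\widetilde\Delta$ and $\Delta_{g_+}$ be the Laplacians (divergence of the gradient) of $\widetilde g$ and $g_+$. Let $\widetilde{\mathcal E}[w]$ be the set of $\widetilde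 u\in C^\infty(\widetilde{\mathcal G})$ with $\widetilde u(\lambda t,x,\rho)=\lambda^w\widetilde u(t,x,\rho)$ for all $\lambda>0$. Let $k\ge 0$ be an integer, $w'\in\mathbb R$, $\widetilde f\in\widetilde{\mathcal E}[w']$, $w=-\frac{n+w'-2k}{2}$, and $\widetilde u\in\widetilde{\mathcal E}[w]$. Define $$\widetilde D_{2k,w,\widetilde f}(\widetilde u)=\sum_{j=0}^k a_j\,\widetilde\Delta^{k-j}\bigl(\widetilde f\,\widetilde\Delta^j\widetilde u\bigr),\qquad a_j=\binom kj\frac{\Gamma(j+k-w-w'-\frac n2)\,\Gamma(\frac n2+w-j)}{\Gamma(k-w-w'-\frac n2)\,\Gamma(\frac n2+w-k)},$$ $$P_{2j,w}=\prod_{i=0}^{j-1}\bigl(\Delta_{g_+}-(w-2i)(n+w-2i)\bigr).$$ Then, with $\widehat u=\widetilde u|_{\mathring X}$ and $\widehat f=\widetilde f|_{\mathring X}$, $$\widetilde D_{2k,w,\widetilde f}(\widetilde u)\big|_{\mathring X}=\sum_{i=0}^k\sum_{j=0}^{k-i}c_{i,j}\,P_{2i,w}\bigl(\widehat f\,P_{2j,w}(\widehat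 u)\bigr),\qquad c_{i,j}=4^{k-i-j}\frac{k!}{i!\,j!}\frac{\Gamma(\frac n2+w-i)\,\Gamma(\frac n2+w-j)}{\Gamma(\frac n2+w-k)^2},$$ and $c_{i,j}=c_{j,i}$. Here each quotient $\Gamma(x+m)/\Gamma(x)$ with $m\in\mathbb N$ that occurs in $a_j$ and $c_{i,j}$ is read as its continuous extension $x(x+1)\cdots(x+m-1)$; this matters only if $w'$ is a nonnegative even integer. -/

import Mathlib

set_option maxSynthPendingDepth 3

open scoped Manifold ContDiff

noncomputable section

namespace PoincareExpansion

/-! ## The Laplacian of a pseudo-Riemannian metric -/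

section Laplacian

variable {E : Type*} [NormedAddCommGroup E] [NormedSpace ℝ E]

/-- Christoffel symbols of the first kind of a metric `G` given on (an open part of) a vector
space: `(X, Y, Z) ↦ ½ (D_X G (Y, Z) + D_Y G (X, Z) - D_Z G (X, Y))`. -/
def christoffelLower (G : E → E →L[ℝ] E →L[ℝ] ℝ) (z : E) : E →L[ℝ] E →L[ℝ] E →L[ℝ] ℝ :=
  let D : E →L[ℝ] E →L[ℝ] E →L[ℝ] ℝ := fderiv ℝ G z
  let F : (E →L[ℝ] E →L[ℝ] ℝ) →L[ℝ] E →L[ℝ] E →L[ℝ] ℝ :=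
    (ContinuousLinearMap.flipₗᵢ ℝ E E ℝ).toContinuousLinearEquiv.toContinuousLinearMap
  let D₃ : E →L[ℝ] E →L[ℝ] E →L[ℝ] ℝ := F.comp D.flip
  (1 / 2 : ℝ) • (D + D.flip - D₃)

theorem christoffelLower_apply (G : E → E →L[ℝ] E →L[ℝ] ℝ) (z X Y Z : E) :
    christoffelLower G z X Y Z =
      1 / 2 * (fderiv ℝ G z X Y Z + fderiv ℝ G z Y X Z - fderiv ℝ G z Z X Y) := by
  have h : christoffelLower G z X Y Z =
      1 / 2 * (fderiv ℝ G z X Y Z + (fderiv ℝ G z).flip X Y Z -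
        ((fderiv ℝ G z).flip X).flip Y Z) := rfl
  rw [h]
  rfl

/-- The metric `G z` raises indices: `sharp G z : E* → E` is the inverse of `X ↦ G z (X, ·)`. -/
def sharp (G : E → E →L[ℝ] E →L[ℝ] ℝ) (z : E) : (E →L[ℝ] ℝ) →L[ℝ] E :=
  ContinuousLinearMap.inverse (G z)

/-- Christoffel symbols of the second kind, as a vector-valued bilinear map `(X, Y) ↦ Γ(X, Y)`. -/
def christoffel (G : E → E →L[ℝ] E →L[ℝ] ℝ) (z : E) : E →L[ℝ] E →L[ℝ] E :=
  ((ContinuousLinearMap.compL ℝ E (E →L[ℝ] ℝ) E) (sharp G z)).comp (christoffelLower G z)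

theorem christoffel_apply (G : E → E →L[ℝ] E →L[ℝ] ℝ) (z X Y : E) :
    christoffel G z X Y = sharp G z (christoffelLower G z X Y) := by
  simp [christoffel]

/-- The covariant Hessian `∇²u (X, Y) = D²u (X, Y) - Du (Γ(X, Y))`. -/
def hessian (G : E → E →L[ℝ] E →L[ℝ] ℝ) (u : E → ℝ) (z : E) : E →L[ℝ] E →L[ℝ] ℝ :=
  fderiv ℝ (fderiv ℝ u) z -
    ((ContinuousLinearMap.compL ℝ E E ℝ) (fderiv ℝ u z)).comp (christoffel G z)

theorem hessian_apply (G : E → E →L[ℝ] E →L[ℝ] ℝ) (u : E → ℝ) (z X Y : E) :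
    hessian G u z X Y =
      fderiv ℝ (fderiv ℝ u) z X Y - fderiv ℝ u z (christoffel G z X Y) := by
  simp [hessian]

/-- The Laplacian `g^{ab} ∇_a ∇_b u` of a metric on (an open part of) a vector space: the trace,
with respect to the metric, of the covariant Hessian. -/
def coordLaplacian (G : E → E →L[ℝ] E →L[ℝ] ℝ) (u : E → ℝ) (z : E) : ℝ :=
  LinearMap.trace ℝ E ((sharp G z).comp (hessian G u z) : E →L[ℝ] E).toLinearMap

variable {H : Type*} [TopologicalSpace H] (I : ModelWithCorners ℝ E H)
  {N : Type*} [TopologicalSpace N] [ChartedSpace H N]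

/-- The expression of a field `g` of bilinear forms on the tangent spaces of a manifold in the
preferred chart at the point `p`: its pullback under the inverse of the chart. -/
def inChart (g : ∀ q : N, TangentSpace I q →L[ℝ] TangentSpace I q →L[ℝ] ℝ) (p : N) (z : E) :
    E →L[ℝ] E →L[ℝ] ℝ :=
  let b : E →L[ℝ] E →L[ℝ] ℝ := g ((extChartAt I p).symm z)
  let d : E →L[ℝ] E := mfderiv 𝓘(ℝ, E) I (extChartAt I p).symm z
  b.bilinearComp d d

/-- The Laplacian (divergence of the gradient) of a pseudo-Riemannian metric `g` on a manifold
without boundary, computed at each point `p` in the preferred chart at `p`. -/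
def laplacian (g : ∀ q : N, TangentSpace I q →L[ℝ] TangentSpace I q →L[ℝ] ℝ)
    (u : N → ℝ) (p : N) : ℝ :=
  coordLaplacian (inChart I g p) (u ∘ (extChartAt I p).symm) (extChartAt I p p)

end Laplacian

/-! ## Pseudo-Riemannian metrics and straight and normal metrics -/

section Metric

variable (n : ℕ) (M : Type*) [TopologicalSpace M] [ChartedSpace (EuclideanSpace ℝ (Fin n)) M]

/-- A field of bilinear forms on the tangent spaces of `M`. -/
abbrev BilinField : Type _ :=
  ∀ x : M, TangentSpace (𝓡 n) x →L[ℝ] TangentSpace (𝓡 n) x →L[ℝ] ℝ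

/-- A smooth pseudo-Riemannian metric, of any signature, on the `n`-dimensional manifold `M`. -/
structure PseudoRiemannianMetric [IsManifold (𝓡 n) ∞ M] where
  /-- the bilinear form on each tangent space -/
  val : BilinField n M
  symm : ∀ (x : M) (X Y : TangentSpace (𝓡 n) x), val x X Y = val x Y X
  nondegenerate : ∀ (x : M) (X : TangentSpace (𝓡 n) x), (∀ Y, val x X Y = 0) → X = 0
  smooth : ContMDiff (𝓡 n)
    ((𝓡 n).prod
      𝓘(ℝ, EuclideanSpace ℝ (Fin n) →L[ℝ] EuclideanSpace ℝ (Fin n) →L[ℝ] ℝ)) ∞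
    (fun x : M => Bundle.TotalSpace.mk'
      (EuclideanSpace ℝ (Fin n) →L[ℝ] EuclideanSpace ℝ (Fin n) →L[ℝ] ℝ)
      (E := fun x : M => TangentSpace (𝓡 n) x →L[ℝ] TangentSpace (𝓡 n) x →L[ℝ] ℝ) x (val x))

/-- The data of a straight and normal metric over `(M, g)`: a number `ε > 0` and a smooth
one-parameter family `g_ρ`, `ρ ∈ (-ε, ε)`, of pseudo-Riemannian metrics on `M` with `g_0 = g`.
(The values of the family for `ρ` outside `(-ε, ε)` are irrelevant.) No curvature condition is
imposed, so this covers every straight and normal pre-ambient metric, in particular the formally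
Ricci-flat ones, which are the ambient metrics. -/
structure StraightNormal {n : ℕ} {M : Type*} [TopologicalSpace M]
    [ChartedSpace (EuclideanSpace ℝ (Fin n)) M] [IsManifold (𝓡 n) ∞ M]
    (g : PseudoRiemannianMetric n M) where
  /-- the size of the interval of parameters -/
  ε : ℝ
  ε_pos : 0 < ε
  /-- the family of metrics -/
  fam : ℝ → BilinField n M
  fam_zero : fam 0 = g.val
  symm : ∀ ρ ∈ Set.Ioo (-ε) ε, ∀ (x : M) (X Y : TangentSpace (𝓡 n) x),
    fam ρ x X Y = fam ρ x Y X
  nondegenerate : ∀ ρ ∈ Set.Ioo (-ε) ε, ∀ (x : M) (X : TangentSpace (𝓡 n) x),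
    (∀ Y, fam ρ x X Y = 0) → X = 0
  smooth : ContMDiffOn (𝓘(ℝ, ℝ).prod (𝓡 n))
    ((𝓡 n).prod
      𝓘(ℝ, EuclideanSpace ℝ (Fin n) →L[ℝ] EuclideanSpace ℝ (Fin n) →L[ℝ] ℝ)) ∞
    (fun p : ℝ × M => Bundle.TotalSpace.mk'
      (EuclideanSpace ℝ (Fin n) →L[ℝ] EuclideanSpace ℝ (Fin n) →L[ℝ] ℝ)
      (E := fun x : M => TangentSpace (𝓡 n) x →L[ℝ] TangentSpace (𝓡 n) x →L[ℝ] ℝ)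
      p.2 (fam p.1 p.2))
    (Set.Ioo (-ε) ε ×ˢ Set.univ)

end Metric

/-! ## The ambient space and the Poincaré space

A representative `g` of the conformal class identifies the metric bundle with `(0, ∞) × M`, so the
ambient space is the open subset `{(t, x, ρ) : t > 0, -ε < ρ < ε}` of `ℝ × M × ℝ`, and the
coordinates `(r, x)` identify the Poincaré space with the open subset
`{(r, x) : 0 < r, r² / 2 < ε}` of `ℝ × M`. Functions on these open sets are represented by
functions on the whole product, of which only the values on the open set matter: all the operators
below are local. -/

/-- The model with corners of `ℝ × M × ℝ`. -/
abbrev ambientModel (n : ℕ) :=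
  𝓘(ℝ, ℝ).prod ((𝓡 n).prod 𝓘(ℝ, ℝ))

/-- The model with corners of `ℝ × M`. -/
abbrev poincareModel (n : ℕ) :=
  𝓘(ℝ, ℝ).prod (𝓡 n)

namespace StraightNormal

variable {n : ℕ} {M : Type*} [TopologicalSpace M] [ChartedSpace (EuclideanSpace ℝ (Fin n)) M]
  [IsManifold (𝓡 n) ∞ M] {g : PseudoRiemannianMetric n M} (A : StraightNormal g)

/-- The ambient space, as an open subset of `ℝ × M × ℝ` with points `(t, x, ρ)`. -/
def space : Set (ℝ × M × ℝ) :=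
  {p | 0 < p.1 ∧ p.2.2 ∈ Set.Ioo (-A.ε) A.ε}

/-- The ambient metric `2ρ dt² + 2t dt dρ + t² g_ρ` at the point `(t, x, ρ)`. -/
def ambientMetric (p : ℝ × M × ℝ) :
    TangentSpace (ambientModel n) p →L[ℝ] TangentSpace (ambientModel n) p →L[ℝ] ℝ :=
  let V := EuclideanSpace ℝ (Fin n)
  let dt : ℝ × V × ℝ →L[ℝ] ℝ := ContinuousLinearMap.fst ℝ ℝ (V × ℝ)
  let dx : ℝ × V × ℝ →L[ℝ] V :=
    (ContinuousLinearMap.fst ℝ V ℝ).comp (ContinuousLinearMap.snd ℝ ℝ (V × ℝ))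
  let dρ : ℝ × V × ℝ →L[ℝ] ℝ :=
    (ContinuousLinearMap.snd ℝ V ℝ).comp (ContinuousLinearMap.snd ℝ ℝ (V × ℝ))
  let mul : ℝ →L[ℝ] ℝ →L[ℝ] ℝ := ContinuousLinearMap.mul ℝ ℝ
  let gρ : V →L[ℝ] V →L[ℝ] ℝ := A.fam p.2.2 p.2.1
  ((2 * p.2.2) • mul.bilinearComp dt dt +
    p.1 • (mul.bilinearComp dt dρ + mul.bilinearComp dρ dt) +
    p.1 ^ 2 • gρ.bilinearComp dx dx : (ℝ × V × ℝ) →L[ℝ] (ℝ × V × ℝ) →L[ℝ] ℝ)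

theorem ambientMetric_apply (t ρ : ℝ) (x : M) (a b a₁ b₁ : ℝ) (X X₁ : TangentSpace (𝓡 n) x) :
    A.ambientMetric (t, x, ρ) (a, X, b) (a₁, X₁, b₁) =
      2 * ρ * (a * a₁) + t * (a * b₁ + b * a₁) + t ^ 2 * A.fam ρ x X X₁ := by
  rfl

/-- The Poincaré metric `r⁻² (dr² + g_{-r²/2})` at the point `(r, x)`. -/
def poincareMetric (q : ℝ × M) :
    TangentSpace (poincareModel n) q →L[ℝ] TangentSpace (poincareModel n) q →L[ℝ] ℝ :=
  let V := EuclideanSpace ℝ (Fin n)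
  let dr : ℝ × V →L[ℝ] ℝ := ContinuousLinearMap.fst ℝ ℝ V
  let dx : ℝ × V →L[ℝ] V := ContinuousLinearMap.snd ℝ ℝ V
  let mul : ℝ →L[ℝ] ℝ →L[ℝ] ℝ := ContinuousLinearMap.mul ℝ ℝ
  let gρ : V →L[ℝ] V →L[ℝ] ℝ := A.fam (-(q.1 ^ 2) / 2) q.2
  ((q.1 ^ 2)⁻¹ • (mul.bilinearComp dr dr + gρ.bilinearComp dx dx) :
    (ℝ × V) →L[ℝ] (ℝ × V) →L[ℝ] ℝ)

theorem poincareMetric_apply (r : ℝ) (x : M) (a a₁ : ℝ) (X X₁ : TangentSpace (𝓡 n) x) :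
    A.poincareMetric (r, x) (a, X) (a₁, X₁) =
      (r ^ 2)⁻¹ * (a * a₁ + A.fam (-(r ^ 2) / 2) x X X₁) := by
  rfl

/-- The Laplacian of the ambient metric. -/
def ambientLaplacian : (ℝ × M × ℝ → ℝ) → (ℝ × M × ℝ → ℝ) :=
  laplacian (ambientModel n) A.ambientMetric

/-- The Laplacian of the Poincaré metric. -/
def poincareLaplacian : (ℝ × M → ℝ) → (ℝ × M → ℝ) :=
  laplacian (poincareModel n) A.poincareMetric

/-- The Poincaré space in the coordinates `(r, x)`. -/
def poincareSpace : Set (ℝ × M) :=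
  {q | 0 < q.1 ∧ q.1 ^ 2 / 2 < A.ε}

/-- The inclusion of the Poincaré space as the hypersurface `{s = 1}` of the ambient space, where
`r = √(-2ρ)` and `s = r t`. -/
def incl (q : ℝ × M) : ℝ × M × ℝ :=
  (q.1⁻¹, q.2, -(q.1 ^ 2) / 2)

/-- The infinitesimal generator `T = t ∂_t` of the dilations. -/
def eulerField (p : ℝ × M × ℝ) : TangentSpace (ambientModel n) p :=
  ((p.1, 0, 0) : ℝ × EuclideanSpace ℝ (Fin n) × ℝ)

/-- The image of the Poincaré space is the hypersurface where the generator of the dilations has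
square length `-1`. -/
theorem incl_image : incl '' A.poincareSpace =
    {p ∈ A.space | A.ambientMetric p (eulerField p) (eulerField p) = -1} := by
  ext ⟨t, x, ρ⟩
  have key : A.ambientMetric (t, x, ρ) (eulerField (t, x, ρ)) (eulerField (t, x, ρ)) =
      2 * ρ * (t * t) := by
    have h := A.ambientMetric_apply t ρ x t 0 t 0 0 0
    simp only [mul_zero, zero_mul, add_zero, map_zero] at h
    exact h
  constructor
  · rintro ⟨⟨r, y⟩, ⟨h0, h1⟩, h⟩
    simp only [incl, Prod.mk.injEq] at h h0 h1
    obtain ⟨rfl, rfl, rfl⟩ := h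
    refine ⟨⟨inv_pos.mpr h0, ?_, ?_⟩, ?_⟩
    · change -A.ε < -(r ^ 2) / 2
      linarith
    · change -(r ^ 2) / 2 < A.ε
      nlinarith
    · rw [key]
      field_simp
  · rintro ⟨⟨ht, hρ, -⟩, h⟩
    rw [key] at h
    simp only at ht hρ
    refine ⟨(t⁻¹, x), ⟨inv_pos.mpr ht, ?_⟩, ?_⟩
    · have : (t⁻¹) ^ 2 / 2 = -ρ := by
        field_simp
        linarith
      change (t⁻¹) ^ 2 / 2 < A.ε
      rw [this]
      linarith
    · simp only [incl, inv_inv, Prod.mk.injEq, true_and]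
      field_simp
      linarith

/-- The space of smooth functions on the ambient space that are homogeneous of weight `w` under
the dilations `(t, x, ρ) ↦ (l t, x, ρ)`, `l > 0`. -/
def Homogeneous (w : ℝ) : Set (ℝ × M × ℝ → ℝ) :=
  {u | ContMDiffOn (ambientModel n) 𝓘(ℝ, ℝ) ∞ u A.space ∧
    ∀ p ∈ A.space, ∀ l : ℝ, 0 < l → u (l * p.1, p.2) = l ^ w * u p}

end StraightNormal

/-! ## The coefficients -/

/-- The quotient `Γ(x + m) / Γ(x)` for `m ∈ ℕ`, extended continuously across the poles of the
numerator and of the denominator: `x (x + 1) ⋯ (x + m - 1)`. -/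
def gammaRatio (x : ℝ) (m : ℕ) : ℝ :=
  ∏ l ∈ Finset.range m, (x + l)

theorem gammaRatio_eq {x : ℝ} (hx : ∀ l : ℕ, x ≠ -l) (m : ℕ) :
    gammaRatio x m = Real.Gamma (x + m) / Real.Gamma x := by
  have h0 : Real.Gamma x ≠ 0 := Real.Gamma_ne_zero hx
  induction m with
  | zero => simp [gammaRatio, h0]
  | succ m ih =>
    have hm : x + m ≠ 0 := fun h => hx m (by linarith)
    have e : gammaRatio x (m + 1) = gammaRatio x m * (x + m) := Finset.prod_range_succ _ _
    rw [e, ih, Nat.cast_succ, ← add_assoc, Real.Gamma_add_one hm]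
    ring

open Filter Topology in
/-- At every `x`, `gammaRatio x m` is the limit of the quotients of values of `Γ` nearby. -/
theorem tendsto_gammaRatio (x : ℝ) (m : ℕ) :
    Tendsto (fun y => Real.Gamma (y + m) / Real.Gamma y) (𝓝[≠] x) (𝓝 (gammaRatio x m)) := by
  have hc : Continuous fun y => gammaRatio y m := by
    unfold gammaRatio
    fun_prop
  refine ((hc.tendsto x).mono_left nhdsWithin_le_nhds).congr' ?_
  have hS : IsClosed ((Set.range fun l : ℕ => (-l : ℝ)) \ {x}) := by
    have hcl : Topology.IsClosedEmbedding (fun l : ℕ => (-l : ℝ)) :=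
      (Homeomorph.neg ℝ).isClosedEmbedding.comp Nat.isClosedEmbedding_coe_real
    have e : (Set.range fun l : ℕ => (-l : ℝ)) \ {x} =
        (fun l : ℕ => (-l : ℝ)) '' {l | (-l : ℝ) ≠ x} := by
      ext y
      constructor
      · rintro ⟨⟨l, rfl⟩, h⟩
        exact ⟨l, h, rfl⟩
      · rintro ⟨l, h, rfl⟩
        exact ⟨⟨l, rfl⟩, h⟩
    rw [e]
    exact hcl.isClosedMap _ (isClosed_discrete _)
  have hx : ((Set.range fun l : ℕ => (-l : ℝ)) \ {x})ᶜ ∈ 𝓝 x :=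
    hS.isOpen_compl.mem_nhds (by simp)
  filter_upwards [nhdsWithin_le_nhds hx, self_mem_nhdsWithin] with y hy hyx
  exact gammaRatio_eq (fun l hl => hy ⟨⟨l, hl.symm⟩, hyx⟩) m

/-- The coefficients
`a_j = binom(k, j) * Γ(j + k - w - v - n/2) / Γ(k - w - v - n/2) * Γ(n/2 + w - j) / Γ(n/2 + w - k)`
for a function of weight `v`. -/
def coeffA (n k : ℕ) (w v : ℝ) (j : ℕ) : ℝ :=
  (k.choose j : ℝ) * gammaRatio (k - w - v - n / 2) j * gammaRatio (n / 2 + w - k) (k - j)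

theorem coeffA_eq (n k : ℕ) (w v : ℝ) (j : ℕ) (hj : j ≤ k)
    (h₁ : ∀ l : ℕ, (k - w - v - n / 2 : ℝ) ≠ -l) (h₂ : ∀ l : ℕ, (n / 2 + w - k : ℝ) ≠ -l) :
    coeffA n k w v j = (k.choose j : ℝ) *
      (Real.Gamma (j + k - w - v - n / 2) * Real.Gamma (n / 2 + w - j)) /
      (Real.Gamma (k - w - v - n / 2) * Real.Gamma (n / 2 + w - k)) := by
  rw [coeffA, gammaRatio_eq h₁, gammaRatio_eq h₂, Nat.cast_sub hj]
  rw [show (n / 2 + w - k + (k - j) : ℝ) = n / 2 + w - j by ring,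
    show (k - w - v - n / 2 + j : ℝ) = j + k - w - v - n / 2 by ring]
  ring

/-- The coefficients
`c_{i,j} = 4^(k-i-j) * k! / (i! j!) * Γ(n/2 + w - i) * Γ(n/2 + w - j) / Γ(n/2 + w - k)²`. -/
def coeffC (n k : ℕ) (w : ℝ) (i j : ℕ) : ℝ :=
  4 ^ (k - i - j) * ((k.factorial : ℝ) / (i.factorial * j.factorial)) *
    (gammaRatio (n / 2 + w - k) (k - i) * gammaRatio (n / 2 + w - k) (k - j))

/-! ## The operators -/

namespace StraightNormal

variable {n : ℕ} {M : Type*} [TopologicalSpace M] [ChartedSpace (EuclideanSpace ℝ (Fin n)) M]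
  [IsManifold (𝓡 n) ∞ M] {g : PseudoRiemannianMetric n M} (A : StraightNormal g)

/-- The operator `u ↦ ∑_{j=0}^k a_j Δ^{k-j} (f Δ^j u)` on the ambient space, where `f` has
weight `v` and `u` has weight `w`. -/
def ambientOperator (k : ℕ) (w v : ℝ) (f u : ℝ × M × ℝ → ℝ) (p : ℝ × M × ℝ) : ℝ :=
  ∑ j ∈ Finset.range (k + 1), coeffA n k w v j *
    A.ambientLaplacian^[k - j] (fun q => f q * A.ambientLaplacian^[j] u q) p

/-- The operator `P_{2j,w} = ∏_{i=0}^{j-1} (Δ_{g₊} - (w - 2i)(n + w - 2i))` on the Poincaré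
space. -/
def poincareOperator (w : ℝ) : ℕ → (ℝ × M → ℝ) → (ℝ × M → ℝ)
  | 0, u => u
  | j + 1, u => fun q =>
      A.poincareLaplacian (poincareOperator w j u) q -
        (w - 2 * j) * (n + w - 2 * j) * poincareOperator w j u q

end StraightNormal

end PoincareExpansion

end

/-! In the coordinates `(s, r, x)` of `coneMap`, the part `ρ < 0` of the ambient space is the cone
`-ds² + s² g₊` over the Poincaré space, which has dimension `n + 1`. On a function `s ^ ω * u` the
cone Laplacian is therefore `s ^ (ω - 2) * (Δ u - ω (n + ω) u)`, where `Δ` is the Laplacian of `g₊`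
(`coordLaplacian_coneMetric`, transferred to the manifold in `IsExtension.ambientLaplacian_apply`).
On homogeneous functions every power of the ambient Laplacian thus becomes a product of factors `Δ -
λ`.

Write `λ_i = (w - 2i)(n + w - 2i)`. Starting from weight `w`, `j` Laplacians give `∏_{i<j} (Δ -
λ_i)`, which is `P_{2j,w}` (`IsExtension.iterate_lower`). The relation between `w` and `v` says that
`f Δ̃^j u`, with `Δ̃` the ambient Laplacian, has weight `2m - n - w` for `m = k - j`. Since `ω (n +
ω)` is invariant under `ω ↦ -n - ω`, the next `m` Laplacians give `∏_{i=1}^m (Δ - λ_i)`, with the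
same numbers `λ_i` (`IsExtension.iterate_upper`).

What remains is algebra in one commuting variable: expand the second kind of product in the first
kind (`upperProduct_eq_sum`) and multiply by `a_j`. The result is `c_{i,j}`
(`coeffA_mul_expansionCoeff`), visibly symmetric. Gamma quotients are used only as polynomials, so
no value of `v` is exceptional.

The geometric work is to pass between charts, for which the coordinate Laplacian must be invariant
under local diffeomorphisms (`coordLaplacian_pullback`). This is used both for transition maps and
for `coneMap`. -/

namespace PoincareExpansion

open Filter Topology

/-! ### Naturality, locality, linearity and smoothness of the coordinate Laplacian. -/

section CoordinateLaplacian

variable {E : Type*} [NormedAddCommGroup E] [NormedSpace ℝ E]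
  {E' : Type*} [NormedAddCommGroup E'] [NormedSpace ℝ E']

theorem differentiableAt_bilinearComp {F : Type*} [NormedAddCommGroup F] [NormedSpace ℝ F]
    {B : F → E' →L[ℝ] E' →L[ℝ] ℝ} {L : F → E →L[ℝ] E'} {z : F}
    (hB : DifferentiableAt ℝ B z) (hL : DifferentiableAt ℝ L z) :
    DifferentiableAt ℝ (fun y => (B y).bilinearComp (L y) (L y)) z := by
  let F₁ : (E' →L[ℝ] E →L[ℝ] ℝ) →L[ℝ] E →L[ℝ] E' →L[ℝ] ℝ :=
    (ContinuousLinearMap.flipₗᵢ ℝ E' E ℝ).toContinuousLinearEquiv.toContinuousLinearMap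
  let F₂ : (E →L[ℝ] E' →L[ℝ] ℝ) →L[ℝ] E' →L[ℝ] E →L[ℝ] ℝ :=
    (ContinuousLinearMap.flipₗᵢ ℝ E E' ℝ).toContinuousLinearEquiv.toContinuousLinearMap
  let F₃ : (E →L[ℝ] E →L[ℝ] ℝ) →L[ℝ] E →L[ℝ] E →L[ℝ] ℝ :=
    (ContinuousLinearMap.flipₗᵢ ℝ E E ℝ).toContinuousLinearEquiv.toContinuousLinearMap
  have h : DifferentiableAt ℝ (fun y => F₃ ((F₂ ((B y).comp (L y))).comp (L y))) z :=
    F₃.differentiableAt.comp z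
      ((F₂.differentiableAt.comp z (hB.clm_comp hL)).clm_comp hL)
  exact h

theorem contDiffAt_bilinearComp {F : Type*} [NormedAddCommGroup F] [NormedSpace ℝ F]
    {B : F → E' →L[ℝ] E' →L[ℝ] ℝ} {L : F → E →L[ℝ] E'} {z : F} {m : WithTop ℕ∞}
    (hB : ContDiffAt ℝ m B z) (hL : ContDiffAt ℝ m L z) :
    ContDiffAt ℝ m (fun y => (B y).bilinearComp (L y) (L y)) z := by
  let F₂ : (E →L[ℝ] E' →L[ℝ] ℝ) →L[ℝ] E' →L[ℝ] E →L[ℝ] ℝ :=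
    (ContinuousLinearMap.flipₗᵢ ℝ E E' ℝ).toContinuousLinearEquiv.toContinuousLinearMap
  let F₃ : (E →L[ℝ] E →L[ℝ] ℝ) →L[ℝ] E →L[ℝ] E →L[ℝ] ℝ :=
    (ContinuousLinearMap.flipₗᵢ ℝ E E ℝ).toContinuousLinearEquiv.toContinuousLinearMap
  have h : ContDiffAt ℝ m (fun y => F₃ ((F₂ ((B y).comp (L y))).comp (L y))) z :=
    F₃.contDiff.contDiffAt.comp z
      ((F₂.contDiff.contDiffAt.comp z (hB.clm_comp hL)).clm_comp hL)
  exact h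

theorem fderiv_apply_apply {F : Type*} [NormedAddCommGroup F] [NormedSpace ℝ F]
    {B : F → E →L[ℝ] E →L[ℝ] ℝ} {z : F} (hB : DifferentiableAt ℝ B z) (W : F) (X Y : E) :
    fderiv ℝ B z W X Y = fderiv ℝ (fun y => B y X Y) z W := by
  have h1 : HasFDerivAt (fun y => B y X) ((fderiv ℝ B z).flip X) z := by
    have := hB.hasFDerivAt.clm_apply (hasFDerivAt_const X z)
    simpa using this
  have h2 := h1.clm_apply (hasFDerivAt_const Y z)
  rw [h2.fderiv]
  simp

/-- The derivative of the pullback of a field of bilinear forms. -/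
theorem fderiv_pullback {G : E' → E' →L[ℝ] E' →L[ℝ] ℝ} {G' : E → E →L[ℝ] E →L[ℝ] ℝ}
    {ψ : E → E'} {z : E} (hψ : ContDiffAt ℝ 2 ψ z) (hG : DifferentiableAt ℝ G (ψ z))
    (hG' : ∀ᶠ y in 𝓝 z, G' y = (G (ψ y)).bilinearComp (fderiv ℝ ψ y) (fderiv ℝ ψ y))
    (W X Y : E) :
    fderiv ℝ G' z W X Y =
      fderiv ℝ G (ψ z) (fderiv ℝ ψ z W) (fderiv ℝ ψ z X) (fderiv ℝ ψ z Y) +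
      G (ψ z) (fderiv ℝ (fderiv ℝ ψ) z W X) (fderiv ℝ ψ z Y) +
      G (ψ z) (fderiv ℝ ψ z X) (fderiv ℝ (fderiv ℝ ψ) z W Y) := by
  have hψ1 : HasFDerivAt ψ (fderiv ℝ ψ z) z := (hψ.differentiableAt (by simp)).hasFDerivAt
  have hψ2 : HasFDerivAt (fderiv ℝ ψ) (fderiv ℝ (fderiv ℝ ψ) z) z :=
    ((hψ.fderiv_right (m := 1) (by norm_num)).differentiableAt (by simp)).hasFDerivAt
  have hGψ : HasFDerivAt (fun y => G (ψ y)) ((fderiv ℝ G (ψ z)).comp (fderiv ℝ ψ z)) z :=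
    hG.hasFDerivAt.comp z hψ1
  have hX := hψ2.clm_apply (hasFDerivAt_const X z)
  have hY := hψ2.clm_apply (hasFDerivAt_const Y z)
  have h := (hGψ.clm_apply hX).clm_apply hY
  rw [Filter.EventuallyEq.fderiv_eq hG', fderiv_apply_apply
    (differentiableAt_bilinearComp hGψ.differentiableAt hψ2.differentiableAt)]
  simp only [ContinuousLinearMap.bilinearComp_apply]
  rw [h.fderiv]
  simp
  ring

/-- Differentiating the pulled-back metric produces six terms with the second derivative of `ψ`. By
symmetry of that derivative and of `G`, four cancel in the Christoffel combination and two coincide,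
which absorbs the factor `1 / 2`. -/
theorem christoffelLower_pullback {G : E' → E' →L[ℝ] E' →L[ℝ] ℝ} {G' : E → E →L[ℝ] E →L[ℝ] ℝ}
    {ψ : E → E'} {z : E} (hψ : ContDiffAt ℝ 2 ψ z) (hG : DifferentiableAt ℝ G (ψ z))
    (hsymm : ∀ X Y, G (ψ z) X Y = G (ψ z) Y X)
    (hG' : ∀ᶠ y in 𝓝 z, G' y = (G (ψ y)).bilinearComp (fderiv ℝ ψ y) (fderiv ℝ ψ y))
    (X Y Z : E) :
    christoffelLower G' z X Y Z =
      christoffelLower G (ψ z) (fderiv ℝ ψ z X) (fderiv ℝ ψ z Y) (fderiv ℝ ψ z Z) +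
      G (ψ z) (fderiv ℝ (fderiv ℝ ψ) z X Y) (fderiv ℝ ψ z Z) := by
  have hB : ∀ V W, fderiv ℝ (fderiv ℝ ψ) z V W = fderiv ℝ (fderiv ℝ ψ) z W V := fun V W =>
    (hψ.isSymmSndFDerivAt (by simp)).eq V W
  simp only [christoffelLower_apply, fderiv_pullback hψ hG hG']
  rw [hB Z X, hB Z Y, hB Y X, hsymm (fderiv ℝ ψ z Y), hsymm (fderiv ℝ ψ z X)
    (fderiv ℝ (fderiv ℝ ψ) z Y Z)]
  ring

/-- Invariance of the Laplacian under a local diffeomorphism. -/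
theorem coordLaplacian_pullback {G : E' → E' →L[ℝ] E' →L[ℝ] ℝ} {G' : E → E →L[ℝ] E →L[ℝ] ℝ}
    {ψ : E → E'} {z : E} {u : E' → ℝ} {u' : E → ℝ} (hψ : ContDiffAt ℝ 2 ψ z)
    (hΦ : (fderiv ℝ ψ z).IsInvertible)
    (hG : DifferentiableAt ℝ G (ψ z)) (hsymm : ∀ X Y, G (ψ z) X Y = G (ψ z) Y X)
    (hinv : (G (ψ z)).IsInvertible) (hu : ContDiffAt ℝ 2 u (ψ z))
    (hG' : ∀ᶠ y in 𝓝 z, G' y = (G (ψ y)).bilinearComp (fderiv ℝ ψ y) (fderiv ℝ ψ y))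
    (hu' : u' =ᶠ[𝓝 z] u ∘ ψ) :
    coordLaplacian G' u' z = coordLaplacian G u (ψ z) := by
  obtain ⟨Φ, hΦ⟩ := hΦ
  have hΦa : ∀ X, fderiv ℝ ψ z X = Φ X := fun X => by rw [← hΦ]; rfl
  obtain ⟨S, hS⟩ := hinv
  have hSa : ∀ X Y, G (ψ z) X Y = S X Y := fun X Y => by rw [← hS]; rfl
  have hG'z : ∀ X Y, G' z X Y = S (Φ X) (Φ Y) := fun X Y => by
    rw [hG'.self_of_nhds, ContinuousLinearMap.bilinearComp_apply, hΦa, hΦa, hSa]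
  let S' : E ≃L[ℝ] (E →L[ℝ] ℝ) :=
    Φ.trans (S.trans (ContinuousLinearEquiv.arrowCongr Φ.symm (ContinuousLinearEquiv.refl ℝ ℝ)))
  have hS' : G' z = S' := by
    ext X Y
    rw [hG'z]
    simp [S']
  have hsharp : sharp G (ψ z) = (S.symm : (E' →L[ℝ] ℝ) →L[ℝ] E') := by
    rw [sharp, ← hS, ContinuousLinearMap.inverse_equiv]
  have hsharp' : sharp G' z = (S'.symm : (E →L[ℝ] ℝ) →L[ℝ] E) := by
    rw [sharp, hS', ContinuousLinearMap.inverse_equiv]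
  have hS'symm : ∀ ξ : E →L[ℝ] ℝ, S'.symm ξ = Φ.symm (S.symm (ξ.comp (Φ.symm : E' →L[ℝ] E))) :=
    fun ξ => by simp [S', ContinuousLinearEquiv.arrowCongr]
  -- The second derivative of `ψ` is the only non-tensorial term. It appears again in `hd2` and
  -- cancels in the covariant Hessian, which is why `hhess` is tensorial.
  have hchr : ∀ X Y, christoffel G' z X Y =
      Φ.symm (christoffel G (ψ z) (Φ X) (Φ Y) + fderiv ℝ (fderiv ℝ ψ) z X Y) := by
    intro X Y
    rw [christoffel_apply, christoffel_apply, hsharp, hsharp']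
    simp only [ContinuousLinearEquiv.coe_coe]
    rw [hS'symm]
    congr 1
    apply S.injective
    rw [map_add, ContinuousLinearEquiv.apply_symm_apply, ContinuousLinearEquiv.apply_symm_apply]
    ext Z
    rw [ContinuousLinearMap.comp_apply, christoffelLower_pullback hψ hG hsymm hG']
    simp [hΦa, hSa]
  have hψ1 : HasFDerivAt ψ (fderiv ℝ ψ z) z := (hψ.differentiableAt (by simp)).hasFDerivAt
  have hψ2 : HasFDerivAt (fderiv ℝ ψ) (fderiv ℝ (fderiv ℝ ψ) z) z :=
    ((hψ.fderiv_right (m := 1) (by norm_num)).differentiableAt (by simp)).hasFDerivAt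
  have hu2 : HasFDerivAt (fderiv ℝ u) (fderiv ℝ (fderiv ℝ u) (ψ z)) (ψ z) :=
    ((hu.fderiv_right (m := 1) (by norm_num)).differentiableAt (by simp)).hasFDerivAt
  have hev : fderiv ℝ u' =ᶠ[𝓝 z] fun y => (fderiv ℝ u (ψ y)).comp (fderiv ℝ ψ y) := by
    filter_upwards [hu'.eventuallyEq_nhds, hψ.eventually (by simp),
      hψ.continuousAt.eventually (hu.eventually (by simp))] with y h1 h2 h3
    rw [h1.fderiv_eq]
    exact fderiv_comp y (h3.differentiableAt (by simp)) (h2.differentiableAt (by simp))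
  have hd2 : ∀ X Y, fderiv ℝ (fderiv ℝ u') z X Y =
      fderiv ℝ (fderiv ℝ u) (ψ z) (Φ X) (Φ Y) +
        fderiv ℝ u (ψ z) (fderiv ℝ (fderiv ℝ ψ) z X Y) := by
    intro X Y
    have h := ((hu2.comp z hψ1).clm_comp hψ2).congr_of_eventuallyEq hev
    rw [h.fderiv]
    simp [hΦa]
    ring
  have hhess : ∀ X Y, hessian G' u' z X Y = hessian G u (ψ z) (Φ X) (Φ Y) := by
    intro X Y
    rw [hessian_apply, hessian_apply, hd2, hchr, hev.self_of_nhds]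
    simp [hΦa]
  -- After raising an index, the two Hessians are endomorphisms conjugate under `Φ`, so their traces
  -- agree.
  have hconj : ((sharp G (ψ z)).comp (hessian G u (ψ z)) : E' →L[ℝ] E').toLinearMap =
      Φ.toLinearEquiv.conj ((sharp G' z).comp (hessian G' u' z) : E →L[ℝ] E).toLinearMap := by
    ext X
    rw [hsharp, hsharp', LinearEquiv.conj_apply]
    simp only [ContinuousLinearMap.coe_coe, ContinuousLinearMap.comp_apply, LinearMap.comp_apply,
      ContinuousLinearEquiv.coe_coe, LinearEquiv.coe_coe]
    rw [hS'symm]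
    change _ = Φ (Φ.symm _)
    rw [ContinuousLinearEquiv.apply_symm_apply]
    congr 1
    ext Y
    rw [ContinuousLinearMap.comp_apply, hhess]
    congr 1
    · change _ = hessian G u (ψ z) (Φ (Φ.symm X))
      simp
    · simp
  rw [coordLaplacian, coordLaplacian, hconj, LinearMap.trace_conj']

theorem coordLaplacian_congr {G G' : E → E →L[ℝ] E →L[ℝ] ℝ} {u u' : E → ℝ} {z : E}
    (hG : G =ᶠ[𝓝 z] G') (hu : u =ᶠ[𝓝 z] u') :
    coordLaplacian G u z = coordLaplacian G' u' z := by
  have h1 : fderiv ℝ u =ᶠ[𝓝 z] fderiv ℝ u' := hu.fderiv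
  simp only [coordLaplacian, hessian, christoffel, christoffelLower, sharp]
  rw [hG.fderiv_eq, hG.self_of_nhds, h1.fderiv_eq, h1.self_of_nhds]

theorem coordLaplacian_smul_add {G : E → E →L[ℝ] E →L[ℝ] ℝ} {u v : E → ℝ} {z : E}
    (hu : ContDiffAt ℝ 2 u z) (hv : ContDiffAt ℝ 2 v z) (c : ℝ) :
    coordLaplacian G (fun y => c * u y + v y) z =
      c * coordLaplacian G u z + coordLaplacian G v z := by
  have hev : fderiv ℝ (fun y => c * u y + v y) =ᶠ[𝓝 z]
      fun y => c • fderiv ℝ u y + fderiv ℝ v y := by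
    filter_upwards [hu.eventually (by simp), hv.eventually (by simp)] with y h1 h2
    have := ((h1.differentiableAt (by simp)).hasFDerivAt.const_mul c).add
      (h2.differentiableAt (by simp)).hasFDerivAt
    exact this.fderiv
  have hu2 : HasFDerivAt (fderiv ℝ u) (fderiv ℝ (fderiv ℝ u) z) z :=
    ((hu.fderiv_right (m := 1) (by norm_num)).differentiableAt (by simp)).hasFDerivAt
  have hv2 : HasFDerivAt (fderiv ℝ v) (fderiv ℝ (fderiv ℝ v) z) z :=
    ((hv.fderiv_right (m := 1) (by norm_num)).differentiableAt (by simp)).hasFDerivAt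
  have h2 := (((hu2.const_smul c).add hv2).congr_of_eventuallyEq hev).fderiv
  have hh : hessian G (fun y => c * u y + v y) z = c • hessian G u z + hessian G v z := by
    ext X Y
    simp only [hessian_apply, h2, hev.self_of_nhds, add_apply,
      smul_apply, smul_eq_mul]
    ring
  simp only [coordLaplacian]
  rw [hh, ContinuousLinearMap.comp_add, ContinuousLinearMap.comp_smul]
  simp

theorem contDiffAt_coordLaplacian [FiniteDimensional ℝ E] {G : E → E →L[ℝ] E →L[ℝ] ℝ}
    {u : E → ℝ} {z : E} (hG : ContDiffAt ℝ ∞ G z) (hinv : (G z).IsInvertible)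
    (hu : ContDiffAt ℝ ∞ u z) : ContDiffAt ℝ ∞ (coordLaplacian G u) z := by
  have : CompleteSpace E := FiniteDimensional.complete ℝ E
  have hu1 : ContDiffAt ℝ ∞ (fderiv ℝ u) z := hu.fderiv_right (by simp)
  have hu2 : ContDiffAt ℝ ∞ (fderiv ℝ (fderiv ℝ u)) z := hu1.fderiv_right (by simp)
  have hG1 : ContDiffAt ℝ ∞ (fderiv ℝ G) z := hG.fderiv_right (by simp)
  have hs : ContDiffAt ℝ ∞ (sharp G) z := hinv.contDiffAt_map_inverse.comp z hG
  let F : (E →L[ℝ] E →L[ℝ] ℝ) →L[ℝ] E →L[ℝ] E →L[ℝ] ℝ :=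
    (ContinuousLinearMap.flipₗᵢ ℝ E E ℝ).toContinuousLinearEquiv.toContinuousLinearMap
  let F' : (E →L[ℝ] E →L[ℝ] E →L[ℝ] ℝ) →L[ℝ] E →L[ℝ] E →L[ℝ] E →L[ℝ] ℝ :=
    (ContinuousLinearMap.flipₗᵢ ℝ E E (E →L[ℝ] ℝ)).toContinuousLinearEquiv.toContinuousLinearMap
  have hf : ContDiffAt ℝ ∞ (fun y => F' (fderiv ℝ G y)) z := F'.contDiff.contDiffAt.comp z hG1
  have hl : ContDiffAt ℝ ∞ (christoffelLower G) z := by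
    have : ContDiffAt ℝ ∞ (fun y => (1 / 2 : ℝ) • (fderiv ℝ G y + F' (fderiv ℝ G y) -
        F.comp (F' (fderiv ℝ G y)))) z :=
      ((hG1.add hf).sub (contDiffAt_const.clm_comp hf)).const_smul _
    exact this
  have hc : ContDiffAt ℝ ∞ (christoffel G) z :=
    ((ContinuousLinearMap.compL ℝ E (E →L[ℝ] ℝ) E).contDiff.contDiffAt.comp z hs).clm_comp hl
  have hh : ContDiffAt ℝ ∞ (hessian G u) z :=
    hu2.sub (((ContinuousLinearMap.compL ℝ E E ℝ).contDiff.contDiffAt.comp z hu1).clm_comp hc)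
  let T : (E →L[ℝ] E) →L[ℝ] ℝ :=
    LinearMap.toContinuousLinearMap
      ((LinearMap.trace ℝ E).comp (ContinuousLinearMap.coeLM ℝ : (E →L[ℝ] E) →ₗ[ℝ] E →ₗ[ℝ] E))
  exact T.contDiff.contDiffAt.comp z (hs.clm_comp hh)

end CoordinateLaplacian

/-! ### The Laplacian of a cone metric on homogeneous functions. -/

section Cone

variable {E : Type*} [NormedAddCommGroup E] [NormedSpace ℝ E]

theorem isInvertible_of_nondegenerate [FiniteDimensional ℝ E] {B : E →L[ℝ] E →L[ℝ] ℝ}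
    (hB : ∀ X, (∀ Y, B X Y = 0) → X = 0) : B.IsInvertible := by
  let B' : E →ₗ[ℝ] (E →L[ℝ] ℝ) := B.toLinearMap
  have hinj : Function.Injective B' := by
    rw [injective_iff_map_eq_zero]
    intro X hX
    refine hB X fun Y => ?_
    change B' X Y = 0
    rw [hX]
    rfl
  have hdim : Module.finrank ℝ E = Module.finrank ℝ (E →L[ℝ] ℝ) := by
    rw [← (LinearMap.toContinuousLinearMap (𝕜 := ℝ) (E := E) (F' := ℝ)).finrank_eq]
    exact (Subspace.dual_finrank_eq (K := ℝ) (V := E)).symm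
  refine ⟨(LinearEquiv.ofInjectiveOfFinrankEq B' hinj hdim).toContinuousLinearEquiv, ?_⟩
  ext X Y
  rfl

/-- Only the diagonal blocks matter: `f` is the sum of its restrictions to the two factors, and
cyclicity of the trace moves each projection to the left. -/
theorem trace_prod {R V W : Type*} [Field R] [AddCommGroup V] [Module R V] [AddCommGroup W]
    [Module R W] [FiniteDimensional R V] [FiniteDimensional R W] (f : V × W →ₗ[R] V × W) :
    LinearMap.trace R (V × W) f =
      LinearMap.trace R V (LinearMap.fst R V W ∘ₗ f ∘ₗ LinearMap.inl R V W) +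
      LinearMap.trace R W (LinearMap.snd R V W ∘ₗ f ∘ₗ LinearMap.inr R V W) := by
  have h : f = (f ∘ₗ LinearMap.inl R V W) ∘ₗ LinearMap.fst R V W +
      (f ∘ₗ LinearMap.inr R V W) ∘ₗ LinearMap.snd R V W := by
    refine LinearMap.ext fun x => ?_
    simp [← map_add]
  conv_lhs => rw [h]
  rw [map_add, LinearMap.trace_comp_comm' _ (LinearMap.fst R V W),
    LinearMap.trace_comp_comm' _ (LinearMap.snd R V W)]

/-- The cone metric `-ds² + s² G`. -/
noncomputable def coneMetric (G : E → E →L[ℝ] E →L[ℝ] ℝ) (p : ℝ × E) :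
    ℝ × E →L[ℝ] ℝ × E →L[ℝ] ℝ :=
  -((ContinuousLinearMap.mul ℝ ℝ).bilinearComp (ContinuousLinearMap.fst ℝ ℝ E)
      (ContinuousLinearMap.fst ℝ ℝ E)) +
    p.1 ^ 2 • (G p.2).bilinearComp (ContinuousLinearMap.snd ℝ ℝ E)
      (ContinuousLinearMap.snd ℝ ℝ E)

theorem coneMetric_apply (G : E → E →L[ℝ] E →L[ℝ] ℝ) (p X Y : ℝ × E) :
    coneMetric G p X Y = -(X.1 * Y.1) + p.1 ^ 2 * G p.2 X.2 Y.2 := rfl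

theorem differentiableAt_coneMetric {G : E → E →L[ℝ] E →L[ℝ] ℝ} {p : ℝ × E}
    (hG : DifferentiableAt ℝ G p.2) : DifferentiableAt ℝ (coneMetric G) p := by
  have h1 : DifferentiableAt ℝ (fun q : ℝ × E => G q.2) p := hG.comp p differentiableAt_snd
  have h2 : DifferentiableAt ℝ (fun q : ℝ × E => (G q.2).bilinearComp
      (ContinuousLinearMap.snd ℝ ℝ E) (ContinuousLinearMap.snd ℝ ℝ E)) p :=
    differentiableAt_bilinearComp h1 (differentiableAt_const _)
  exact (differentiableAt_const _).add ((differentiableAt_fst.pow 2).smul h2)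

theorem fderiv_coneMetric {G : E → E →L[ℝ] E →L[ℝ] ℝ} {p : ℝ × E}
    (hG : DifferentiableAt ℝ G p.2) (W X Y : ℝ × E) :
    fderiv ℝ (coneMetric G) p W X Y =
      2 * p.1 * W.1 * G p.2 X.2 Y.2 + p.1 ^ 2 * fderiv ℝ G p.2 W.2 X.2 Y.2 := by
  rw [fderiv_apply_apply (differentiableAt_coneMetric hG)]
  have h1 : HasFDerivAt (fun q : ℝ × E => G q.2)
      ((fderiv ℝ G p.2).comp (ContinuousLinearMap.snd ℝ ℝ E)) p :=
    hG.hasFDerivAt.comp p hasFDerivAt_snd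
  have h2 := (h1.clm_apply (hasFDerivAt_const X.2 p)).clm_apply (hasFDerivAt_const Y.2 p)
  have h3 := (((hasFDerivAt_fst (𝕜 := ℝ) (E := ℝ) (F := E) (p := p)).pow 2).mul h2).const_add
    (-(X.1 * Y.1))
  simp only [coneMetric_apply]
  refine (congrArg (fun L => L W) h3.fderiv).trans ?_
  simp
  ring

theorem isInvertible_coneMetric [FiniteDimensional ℝ E] {G : E → E →L[ℝ] E →L[ℝ] ℝ} {p : ℝ × E}
    (hp : p.1 ≠ 0) (hG : (G p.2).IsInvertible) : (coneMetric G p).IsInvertible := by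
  refine isInvertible_of_nondegenerate fun X hX => ?_
  ext
  · simpa [coneMetric_apply] using hX (1, 0)
  · refine hG.injective ?_
    ext Y
    simpa [coneMetric_apply, hp] using hX (0, Y)

theorem sharp_coneMetric [FiniteDimensional ℝ E] {G : E → E →L[ℝ] E →L[ℝ] ℝ} {p : ℝ × E}
    (hp : p.1 ≠ 0) (hG : (G p.2).IsInvertible) (ξ : ℝ × E →L[ℝ] ℝ) :
    sharp (coneMetric G) p ξ =
      (-ξ (1, 0), (p.1 ^ 2)⁻¹ • sharp G p.2 (ξ.comp (ContinuousLinearMap.inr ℝ ℝ E))) := by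
  rw [sharp, (isInvertible_coneMetric hp hG).inverse_apply_eq]
  ext
  · simp [coneMetric_apply]
  · simp [coneMetric_apply, sharp, hG.self_apply_inverse, hp]

/-- Verified by lowering the index, where the claim becomes an identity between first derivatives of
the cone metric. Only the derivative of the factor `s²` adds to the Christoffel symbols of `G`. -/
theorem christoffel_coneMetric [FiniteDimensional ℝ E] {G : E → E →L[ℝ] E →L[ℝ] ℝ} {p : ℝ × E}
    (hp : p.1 ≠ 0) (hG : DifferentiableAt ℝ G p.2) (hinv : (G p.2).IsInvertible)
    (hsymm : ∀ X Y, G p.2 X Y = G p.2 Y X) (X Y : ℝ × E) :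
    christoffel (coneMetric G) p X Y =
      (p.1 * G p.2 X.2 Y.2,
        christoffel G p.2 X.2 Y.2 + (X.1 / p.1) • Y.2 + (Y.1 / p.1) • X.2) := by
  rw [christoffel_apply, christoffel_apply, sharp,
    (isInvertible_coneMetric hp hinv).inverse_apply_eq]
  have h0 : ∀ Z, G p.2 (sharp G p.2 (christoffelLower G p.2 X.2 Y.2)) Z =
      christoffelLower G p.2 X.2 Y.2 Z := fun Z => by rw [sharp, hinv.self_apply_inverse]
  apply ContinuousLinearMap.ext
  intro Z
  simp only [christoffelLower_apply, fderiv_coneMetric hG, coneMetric_apply, map_add, map_smul,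
    add_apply, smul_apply, smul_eq_mul, h0]
  field_simp
  rw [hsymm X.2 Y.2]
  ring

/-- The mixed coefficient drops from `w` to `w - 1` because of the components `Y / s` of the
Christoffel symbols. The term with `G` comes from their radial component `s G`, paired with the
`s`-derivative of `s ^ w * u`. -/
theorem hessian_coneMetric [FiniteDimensional ℝ E] {G : E → E →L[ℝ] E →L[ℝ] ℝ} {p : ℝ × E}
    (hp : 0 < p.1) (hG : DifferentiableAt ℝ G p.2) (hinv : (G p.2).IsInvertible)
    (hsymm : ∀ X Y, G p.2 X Y = G p.2 Y X) {u : E → ℝ} (hu : ContDiffAt ℝ 2 u p.2) (w : ℝ)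
    (X Y : ℝ × E) :
    hessian (coneMetric G) (fun q => q.1 ^ w * u q.2) p X Y =
      w * (w - 1) * p.1 ^ (w - 2) * u p.2 * X.1 * Y.1 +
      (w - 1) * p.1 ^ (w - 1) * (X.1 * fderiv ℝ u p.2 Y.2 + Y.1 * fderiv ℝ u p.2 X.2) +
      p.1 ^ w * (hessian G u p.2 X.2 Y.2 - w * u p.2 * G p.2 X.2 Y.2) := by
  let fstL := ContinuousLinearMap.fst ℝ ℝ E
  let sndL := ContinuousLinearMap.snd ℝ ℝ E
  have hpow : ∀ (q : ℝ × E) (m : ℝ), 0 < q.1 →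
      HasFDerivAt (fun q : ℝ × E => q.1 ^ m) ((m * q.1 ^ (m - 1)) • fstL) q := fun q m hq =>
    (hasFDerivAt_fst (𝕜 := ℝ) (E := ℝ) (F := E) (p := q)).rpow_const (Or.inl hq.ne')
  have hev : fderiv ℝ (fun q : ℝ × E => q.1 ^ w * u q.2) =ᶠ[𝓝 p] fun q =>
      q.1 ^ w • (fderiv ℝ u q.2).comp sndL + u q.2 • (w * q.1 ^ (w - 1)) • fstL := by
    filter_upwards [(continuous_fst.tendsto p).eventually (lt_mem_nhds hp),
      (continuous_snd.tendsto p).eventually (hu.eventually (by simp))] with q h1 h2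
    exact ((hpow q w h1).mul
      ((h2.differentiableAt (by simp)).hasFDerivAt.comp q hasFDerivAt_snd)).fderiv
  have hu1 : HasFDerivAt (fun q : ℝ × E => u q.2) ((fderiv ℝ u p.2).comp sndL) p :=
    (hu.differentiableAt (by simp)).hasFDerivAt.comp p hasFDerivAt_snd
  have hu2 : HasFDerivAt (fun q : ℝ × E => fderiv ℝ u q.2)
      ((fderiv ℝ (fderiv ℝ u) p.2).comp sndL) p :=
    ((hu.fderiv_right (m := 1) (by norm_num)).differentiableAt (by simp)).hasFDerivAt.comp p
      hasFDerivAt_snd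
  have h2 := (((hpow p w hp).smul (hu2.clm_comp (hasFDerivAt_const sndL p))).add
    (hu1.smul (((hpow p (w - 1) hp).const_mul w).smul (hasFDerivAt_const fstL p))))
  rw [hessian_apply, hessian_apply, (h2.congr_of_eventuallyEq hev).fderiv, hev.self_of_nhds,
    christoffel_coneMetric hp.ne' hG hinv hsymm]
  have e1 : p.1 ^ w = p.1 ^ (w - 2) * p.1 ^ 2 := by
    rw [← Real.rpow_natCast, ← Real.rpow_add hp]
    norm_num
  have e2 : p.1 ^ (w - 1) = p.1 ^ (w - 2) * p.1 := by
    rw [← Real.rpow_add_one hp.ne']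
    ring_nf
  simp [fstL, sndL]
  rw [show w - 1 - 1 = w - 2 by ring, e1, e2]
  have := hp.ne'
  field_simp
  ring

/-- The Laplacian of the cone metric on a homogeneous function. -/
theorem coordLaplacian_coneMetric [FiniteDimensional ℝ E] {G : E → E →L[ℝ] E →L[ℝ] ℝ}
    {p : ℝ × E} (hp : 0 < p.1) (hG : DifferentiableAt ℝ G p.2) (hinv : (G p.2).IsInvertible)
    (hsymm : ∀ X Y, G p.2 X Y = G p.2 Y X) {u : E → ℝ} (hu : ContDiffAt ℝ 2 u p.2) (w : ℝ) :
    coordLaplacian (coneMetric G) (fun q => q.1 ^ w * u q.2) p =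
      p.1 ^ (w - 2) * (coordLaplacian G u p.2 -
        w * (w + Module.finrank ℝ E - 1) * u p.2) := by
  rw [coordLaplacian, trace_prod]
  -- The mixed terms are off-diagonal and do not enter the trace. The radial block contributes `-w
  -- (w - 1) u` and the metric term of the other block `-w u * dim E`, both times `s ^ (w - 2)`;
  -- together they give `-w (w + dim E - 1) u`.
  have hh := hessian_coneMetric hp hG hinv hsymm hu w
  have h1 : LinearMap.fst ℝ ℝ E ∘ₗ ((sharp (coneMetric G) p).comp
      (hessian (coneMetric G) (fun q => q.1 ^ w * u q.2) p) :
        ℝ × E →L[ℝ] ℝ × E).toLinearMap ∘ₗ LinearMap.inl ℝ ℝ E =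
      (-(w * (w - 1) * p.1 ^ (w - 2) * u p.2)) • LinearMap.id := by
    ext
    simp [sharp_coneMetric hp.ne' hinv, hh]
  have h2 : LinearMap.snd ℝ ℝ E ∘ₗ ((sharp (coneMetric G) p).comp
      (hessian (coneMetric G) (fun q => q.1 ^ w * u q.2) p) :
        ℝ × E →L[ℝ] ℝ × E).toLinearMap ∘ₗ LinearMap.inr ℝ ℝ E =
      p.1 ^ (w - 2) • (((sharp G p.2).comp (hessian G u p.2) : E →L[ℝ] E).toLinearMap -
        (w * u p.2) • LinearMap.id) := by
    ext X
    have e : (hessian (coneMetric G) (fun q => q.1 ^ w * u q.2) p (0, X)).comp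
        (ContinuousLinearMap.inr ℝ ℝ E) =
        p.1 ^ w • (hessian G u p.2 X - (w * u p.2) • G p.2 X) := by
      ext Y
      simp [hh]
    have e1 : p.1 ^ w = p.1 ^ 2 * p.1 ^ (w - 2) := by
      rw [← Real.rpow_natCast, ← Real.rpow_add hp]
      norm_num
    simp [sharp_coneMetric hp.ne' hinv, e, e1]
    rw [smul_smul, ← mul_assoc, inv_mul_cancel₀ (by positivity), one_mul, sharp,
      hinv.inverse_apply_self]
  rw [h1, h2]
  simp [coordLaplacian]
  ring

end Cone

/-! ### The ambient metric as a cone metric. -/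

section ConeCoordinates

variable {V : Type*} [NormedAddCommGroup V] [NormedSpace ℝ V]

/-- The bilinear form `2ρ dt² + 2t dt dρ + t² B`. -/
noncomputable def ambientForm (t ρ : ℝ) (B : V →L[ℝ] V →L[ℝ] ℝ) :
    ℝ × V × ℝ →L[ℝ] ℝ × V × ℝ →L[ℝ] ℝ :=
  let dt : ℝ × V × ℝ →L[ℝ] ℝ := ContinuousLinearMap.fst ℝ ℝ (V × ℝ)
  let dx : ℝ × V × ℝ →L[ℝ] V :=
    (ContinuousLinearMap.fst ℝ V ℝ).comp (ContinuousLinearMap.snd ℝ ℝ (V × ℝ))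
  let dρ : ℝ × V × ℝ →L[ℝ] ℝ :=
    (ContinuousLinearMap.snd ℝ V ℝ).comp (ContinuousLinearMap.snd ℝ ℝ (V × ℝ))
  let mul : ℝ →L[ℝ] ℝ →L[ℝ] ℝ := ContinuousLinearMap.mul ℝ ℝ
  (2 * ρ) • mul.bilinearComp dt dt +
    t • (mul.bilinearComp dt dρ + mul.bilinearComp dρ dt) +
    t ^ 2 • B.bilinearComp dx dx

theorem ambientForm_apply (t ρ : ℝ) (B : V →L[ℝ] V →L[ℝ] ℝ) (X Y : ℝ × V × ℝ) :
    ambientForm t ρ B X Y = 2 * ρ * (X.1 * Y.1) + t * (X.1 * Y.2.2 + X.2.2 * Y.1) +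
      t ^ 2 * B X.2.1 Y.2.1 := rfl

/-- The bilinear form `r⁻² (dr² + B)`. -/
noncomputable def poincareForm (r : ℝ) (B : V →L[ℝ] V →L[ℝ] ℝ) :
    ℝ × V →L[ℝ] ℝ × V →L[ℝ] ℝ :=
  (r ^ 2)⁻¹ • ((ContinuousLinearMap.mul ℝ ℝ).bilinearComp (ContinuousLinearMap.fst ℝ ℝ V)
      (ContinuousLinearMap.fst ℝ ℝ V) +
    B.bilinearComp (ContinuousLinearMap.snd ℝ ℝ V) (ContinuousLinearMap.snd ℝ ℝ V))

theorem poincareForm_apply (r : ℝ) (B : V →L[ℝ] V →L[ℝ] ℝ) (X Y : ℝ × V) :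
    poincareForm r B X Y = (r ^ 2)⁻¹ * (X.1 * Y.1 + B X.2 Y.2) := rfl

theorem isInvertible_ambientForm [FiniteDimensional ℝ V] {t : ℝ} (ht : t ≠ 0) (ρ : ℝ)
    {B : V →L[ℝ] V →L[ℝ] ℝ} (hB : B.IsInvertible) : (ambientForm t ρ B).IsInvertible := by
  refine isInvertible_of_nondegenerate fun X hX => ?_
  -- The order matters: pairing with `∂_ρ` sees only the `t`-component, and once this vanishes,
  -- pairing with `∂_t` isolates the `ρ`-component, whatever the sign of `ρ`.
  have h1 : X.1 = 0 := by simpa [ambientForm_apply, ht] using hX (0, 0, 1)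
  have h2 : X.2.2 = 0 := by simpa [ambientForm_apply, ht, h1] using hX (1, 0, 0)
  have h3 : X.2.1 = 0 := by
    refine hB.injective ?_
    ext Y
    simpa [ambientForm_apply, ht] using hX (0, Y, 0)
  exact Prod.ext h1 (Prod.ext h3 h2)

theorem isInvertible_poincareForm [FiniteDimensional ℝ V] {r : ℝ} (hr : r ≠ 0)
    {B : V →L[ℝ] V →L[ℝ] ℝ} (hB : B.IsInvertible) : (poincareForm r B).IsInvertible := by
  refine isInvertible_of_nondegenerate fun X hX => ?_
  have h1 : X.1 = 0 := by simpa [poincareForm_apply, hr] using hX (1, 0)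
  have h2 : X.2 = 0 := by
    refine hB.injective ?_
    ext Y
    simpa [poincareForm_apply, hr] using hX (0, Y)
  exact Prod.ext h1 h2

theorem contDiffAt_ambientForm {F : Type*} [NormedAddCommGroup F] [NormedSpace ℝ F]
    {t ρ : F → ℝ} {B : F → V →L[ℝ] V →L[ℝ] ℝ} {z : F} {m : WithTop ℕ∞} (ht : ContDiffAt ℝ m t z)
    (hρ : ContDiffAt ℝ m ρ z) (hB : ContDiffAt ℝ m B z) :
    ContDiffAt ℝ m (fun y => ambientForm (t y) (ρ y) (B y)) z :=
  (((contDiffAt_const.mul hρ).smul contDiffAt_const).add (ht.smul contDiffAt_const)).add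
    ((ht.pow 2).smul (contDiffAt_bilinearComp hB contDiffAt_const))

theorem contDiffAt_poincareForm {F : Type*} [NormedAddCommGroup F] [NormedSpace ℝ F]
    {r : F → ℝ} {B : F → V →L[ℝ] V →L[ℝ] ℝ} {z : F} {m : WithTop ℕ∞} (hr : ContDiffAt ℝ m r z)
    (h0 : r z ≠ 0) (hB : ContDiffAt ℝ m B z) :
    ContDiffAt ℝ m (fun y => poincareForm (r y) (B y)) z :=
  ((hr.pow 2).inv (by positivity)).smul
    (contDiffAt_const.add (contDiffAt_bilinearComp hB contDiffAt_const))

/-- The coordinates `(t, x, ρ) = (s / r, x, -r² / 2)`. -/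
noncomputable def coneMap {M : Type*} (p : ℝ × ℝ × M) : ℝ × M × ℝ :=
  (p.1 / p.2.1, p.2.2, -(p.2.1 ^ 2) / 2)

theorem contDiffAt_coneMap {p : ℝ × ℝ × V} (hp : p.2.1 ≠ 0) {m : WithTop ℕ∞} :
    ContDiffAt ℝ m (coneMap : ℝ × ℝ × V → ℝ × V × ℝ) p := by
  have h1 : ContDiffAt ℝ m (fun q : ℝ × ℝ × V => q.2.1) p := contDiffAt_snd.fst
  exact (contDiffAt_fst.div h1 hp).prodMk
    (contDiffAt_snd.snd.prodMk (((h1.pow 2).neg).div_const 2))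

theorem fderiv_coneMap {p : ℝ × ℝ × V} (hp : p.2.1 ≠ 0) (X : ℝ × ℝ × V) :
    fderiv ℝ (coneMap : ℝ × ℝ × V → ℝ × V × ℝ) p X =
      (X.1 / p.2.1 - p.1 * X.2.1 / p.2.1 ^ 2, X.2.2, -(p.2.1 * X.2.1)) := by
  have h1 : HasFDerivAt (fun q : ℝ × ℝ × V => q.2.1)
    ((ContinuousLinearMap.fst ℝ ℝ V).comp (ContinuousLinearMap.snd ℝ ℝ (ℝ × V))) p :=
    hasFDerivAt_snd.fst
  have h2 : HasFDerivAt (fun q : ℝ × ℝ × V => q.2.2)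
    ((ContinuousLinearMap.snd ℝ ℝ V).comp (ContinuousLinearMap.snd ℝ ℝ (ℝ × V))) p :=
    hasFDerivAt_snd.snd
  have h0 : HasFDerivAt (fun q : ℝ × ℝ × V => q.1)
    (ContinuousLinearMap.fst ℝ ℝ (ℝ × V)) p := hasFDerivAt_fst
  have h := (h0.mul ((hasDerivAt_inv hp).comp_hasFDerivAt p h1)).prodMk
    (h2.prodMk (((h1.pow 2).neg).mul_const (2⁻¹ : ℝ)))
  have e : (coneMap : ℝ × ℝ × V → ℝ × V × ℝ) = fun q =>
      (q.1 * (q.2.1)⁻¹, q.2.2, -(q.2.1 ^ 2) * 2⁻¹) := rfl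
  rw [e]
  have h' := h.fderiv
  refine (congrArg (fun L => L X) h').trans ?_
  ext
  · simp
    ring
  · simp
  · simp
    ring

theorem isInvertible_fderiv_coneMap [FiniteDimensional ℝ V] {p : ℝ × ℝ × V} (hp : p.2.1 ≠ 0) :
    (fderiv ℝ (coneMap : ℝ × ℝ × V → ℝ × V × ℝ) p).IsInvertible := by
  have hinj : Function.Injective
      (fderiv ℝ (coneMap : ℝ × ℝ × V → ℝ × V × ℝ) p).toLinearMap := by
    rw [injective_iff_map_eq_zero]
    intro X hX
    rw [ContinuousLinearMap.coe_coe, fderiv_coneMap hp] at hX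
    simp only [Prod.mk_eq_zero, neg_eq_zero, mul_eq_zero, hp, false_or] at hX
    obtain ⟨h1, h2, h3⟩ := hX
    rw [h3] at h1
    have h4 : X.1 = 0 := by simpa [hp] using h1
    exact Prod.ext h4 (Prod.ext h3 h2)
  refine ⟨(LinearEquiv.ofInjectiveOfFinrankEq _ hinj ?_).toContinuousLinearEquiv, ?_⟩
  · simp
    ring
  · ext X <;> rfl

/-- With `t = s / r` and `ρ = -r² / 2` one has `r dt = ds - (s / r) dr`, and `2ρ dt² + 2t dt dρ`
factors as `-(ds - (s / r) dr)(ds + (s / r) dr) = -ds² + s² r⁻² dr²`. -/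
theorem coneMetric_eq_pullback (h : ℝ → V → V →L[ℝ] V →L[ℝ] ℝ) {p : ℝ × ℝ × V}
    (hp : p.2.1 ≠ 0) :
    coneMetric (fun q : ℝ × V => poincareForm q.1 (h (-(q.1 ^ 2) / 2) q.2)) p =
      (ambientForm (coneMap p).1 (coneMap p).2.2 (h (coneMap p).2.2 (coneMap p).2.1)).bilinearComp
        (fderiv ℝ coneMap p) (fderiv ℝ coneMap p) := by
  refine ContinuousLinearMap.ext fun X => ContinuousLinearMap.ext fun Y => ?_
  rw [ContinuousLinearMap.bilinearComp_apply, fderiv_coneMap hp, fderiv_coneMap hp,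
    coneMetric_apply, ambientForm_apply, poincareForm_apply]
  simp only [coneMap]
  field_simp
  ring

end ConeCoordinates

/-! ### Metrics in charts and independence of the Laplacian from the chart. -/

section InChart

variable {E : Type*} [NormedAddCommGroup E] [NormedSpace ℝ E]
  {H : Type*} [TopologicalSpace H] {I : ModelWithCorners ℝ E H}
  {N : Type*} [TopologicalSpace N] [ChartedSpace H N]

theorem inChart_apply (g : ∀ q : N, TangentSpace I q →L[ℝ] TangentSpace I q →L[ℝ] ℝ) (p : N)
    (z X Y : E) :
    inChart I g p z X Y = g ((extChartAt I p).symm z)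
      (mfderiv 𝓘(ℝ, E) I (extChartAt I p).symm z X)
      (mfderiv 𝓘(ℝ, E) I (extChartAt I p).symm z Y) := rfl

theorem inChart_symm {g : ∀ q : N, TangentSpace I q →L[ℝ] TangentSpace I q →L[ℝ] ℝ} (p : N)
    {z : E} (hg : ∀ X Y, g ((extChartAt I p).symm z) X Y = g ((extChartAt I p).symm z) Y X)
    (X Y : E) : inChart I g p z X Y = inChart I g p z Y X := hg _ _

end InChart

section ChartIndependence

variable {E : Type*} [NormedAddCommGroup E] [NormedSpace ℝ E]
  {H : Type*} [TopologicalSpace H] {I : ModelWithCorners ℝ E H} [I.Boundaryless]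
  {N : Type*} [TopologicalSpace N] [ChartedSpace H N] [IsManifold I ∞ N]

theorem contMDiffAt_extChartAt_symm_of_mem (p : N) {z : E} (hz : z ∈ (extChartAt I p).target) :
    ContMDiffAt 𝓘(ℝ, E) I ∞ (extChartAt I p).symm z := by
  have h := contMDiffWithinAt_extChartAt_symm_range (I := I) (n := ∞) p hz
  rwa [I.range_eq_univ, contMDiffWithinAt_univ] at h

theorem isInvertible_mfderiv_extChartAt_symm_of_mem (p : N) {z : E}
    (hz : z ∈ (extChartAt I p).target) :
    (mfderiv 𝓘(ℝ, E) I (extChartAt I p).symm z).IsInvertible := by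
  have : IsManifold I 1 N := IsManifold.of_le (n := ∞) (by simp)
  have h := isInvertible_mfderivWithin_extChartAt_symm (I := I) hz
  rwa [I.range_eq_univ, mfderivWithin_univ] at h

theorem isInvertible_inChart [FiniteDimensional ℝ E]
    {g : ∀ q : N, TangentSpace I q →L[ℝ] TangentSpace I q →L[ℝ] ℝ} (p : N) {z : E}
    (hz : z ∈ (extChartAt I p).target)
    (hg : ∀ X, (∀ Y, g ((extChartAt I p).symm z) X Y = 0) → X = 0) :
    (inChart I g p z).IsInvertible := by
  have hi := isInvertible_mfderiv_extChartAt_symm_of_mem (I := I) p hz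
  refine isInvertible_of_nondegenerate fun X hX => ?_
  have h0 : mfderiv 𝓘(ℝ, E) I (extChartAt I p).symm z X = 0 := by
    refine hg _ fun Y => ?_
    obtain ⟨Y', rfl⟩ := hi.surjective Y
    exact hX Y'
  exact hi.injective (h0.trans (map_zero _).symm)

/-- The transition map from the preferred chart at `q` to the preferred chart at `p`. -/
noncomputable def transition (I : ModelWithCorners ℝ E H) (p q : N) (z : E) : E :=
  extChartAt I p ((extChartAt I q).symm z)

theorem eventually_mem_of_mem_source {p q : N} (hq : q ∈ (extChartAt I p).source) :
    ∀ᶠ z in 𝓝 (extChartAt I q q), z ∈ (extChartAt I q).target ∧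
      (extChartAt I q).symm z ∈ (extChartAt I p).source := by
  have h1 := extChartAt_target_mem_nhds (I := I) q
  have h2 : Tendsto (extChartAt I q).symm (𝓝 (extChartAt I q q)) (𝓝 q) := by
    have := (contMDiffAt_extChartAt_symm_of_mem q (mem_extChartAt_target (I := I) q)).continuousAt
    rwa [ContinuousAt, extChartAt_to_inv] at this
  exact (show ∀ᶠ z in 𝓝 (extChartAt I q q), z ∈ (extChartAt I q).target from h1).and (h2.eventually ((isOpen_extChartAt_source p).mem_nhds hq))

theorem contDiffAt_transition {p q : N} {z : E} (hz : z ∈ (extChartAt I q).target)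
    (hz' : (extChartAt I q).symm z ∈ (extChartAt I p).source) :
    ContDiffAt ℝ ∞ (transition I p q) z := by
  have h1 := contMDiffAt_extChartAt_symm_of_mem (I := I) q hz
  rw [extChartAt_source] at hz'
  have h2 : ContMDiffAt I 𝓘(ℝ, E) ∞ (extChartAt I p) ((extChartAt I q).symm z) :=
    contMDiffAt_extChartAt' hz'
  exact contMDiffAt_iff_contDiffAt.mp (h2.comp z h1)

/-- The chain rule for the inverse chart at `q`, factored near `z` through the inverse chart at `p`.
It makes the two local expressions of a metric pullbacks of each other under `transition`. -/
theorem mfderiv_extChartAt_symm_eq {p q : N} {z : E}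
    (hz : ∀ᶠ y in 𝓝 z, y ∈ (extChartAt I q).target ∧
      (extChartAt I q).symm y ∈ (extChartAt I p).source) (X : E) :
    (mfderiv 𝓘(ℝ, E) I (extChartAt I q).symm z X : E) =
      mfderiv 𝓘(ℝ, E) I (extChartAt I p).symm (transition I p q z)
        (fderiv ℝ (transition I p q) z X) := by
  have hz0 := hz.self_of_nhds
  have he : (extChartAt I q).symm =ᶠ[𝓝 z] (extChartAt I p).symm ∘ transition I p q := by
    filter_upwards [hz] with y hy
    exact ((extChartAt I p).left_inv hy.2).symm
  have h1 : MDifferentiableAt 𝓘(ℝ, E) 𝓘(ℝ, E) (transition I p q) z :=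
    ((contDiffAt_transition hz0.1 hz0.2).differentiableAt (by simp)).mdifferentiableAt
  have h2 : MDifferentiableAt 𝓘(ℝ, E) I (extChartAt I p).symm (transition I p q z) :=
    (contMDiffAt_extChartAt_symm_of_mem p ((extChartAt I p).map_source hz0.2)).mdifferentiableAt
      (by simp)
  have h3 := he.mfderiv_eq (I := 𝓘(ℝ, E)) (I' := I)
  have h4 := mfderiv_comp z h2 h1
  rw [mfderiv_eq_fderiv] at h4
  exact congrArg (fun L : E →L[ℝ] E => L X) (h3.trans h4)

/-- `laplacian` changes its chart with the point. This fixes one chart for all nearby points,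
without which smoothness of `laplacian I g u` could not be read off. -/
theorem laplacian_eq_coordLaplacian [FiniteDimensional ℝ E]
    {g : ∀ q : N, TangentSpace I q →L[ℝ] TangentSpace I q →L[ℝ] ℝ} {u : N → ℝ}
    {p q : N} (hq : q ∈ (extChartAt I p).source)
    (hG : DifferentiableAt ℝ (inChart I g p) (extChartAt I p q))
    (hsymm : ∀ X Y, inChart I g p (extChartAt I p q) X Y = inChart I g p (extChartAt I p q) Y X)
    (hinv : (inChart I g p (extChartAt I p q)).IsInvertible)
    (hu : ContDiffAt ℝ 2 (u ∘ (extChartAt I p).symm) (extChartAt I p q)) :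
    laplacian I g u q =
      coordLaplacian (inChart I g p) (u ∘ (extChartAt I p).symm) (extChartAt I p q) := by
  have hev := eventually_mem_of_mem_source hq
  have hev0 := hev.self_of_nhds
  have hz : transition I p q (extChartAt I q q) = extChartAt I p q := by
    rw [transition, extChartAt_to_inv]
  have hψ := contDiffAt_transition hev0.1 hev0.2
  rw [← hz] at hG hsymm hinv hu ⊢
  refine coordLaplacian_pullback (hψ.of_le (by norm_cast)) ?_
    hG hsymm hinv hu ?_ ?_
  -- A kernel vector of the transition derivative is also killed by the derivative of the inverse
  -- chart at `q`, which is invertible.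
  · have hinj : Function.Injective
        (fderiv ℝ (transition I p q) (extChartAt I q q)).toLinearMap := by
      rw [injective_iff_map_eq_zero]
      intro X hX
      have h := mfderiv_extChartAt_symm_eq hev X
      rw [ContinuousLinearMap.coe_coe] at hX
      rw [hX] at h
      exact (isInvertible_mfderiv_extChartAt_symm_of_mem q hev0.1).injective
        ((h.trans (map_zero _)).trans (map_zero _).symm)
    refine ⟨(LinearEquiv.ofInjectiveEndo _ hinj).toContinuousLinearEquiv, ?_⟩
    ext X
    rfl
  · filter_upwards [hev.eventually_nhds] with y hy
    refine ContinuousLinearMap.ext fun X => ContinuousLinearMap.ext fun Y => ?_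
    rw [ContinuousLinearMap.bilinearComp_apply, inChart_apply, inChart_apply]
    have hX := mfderiv_extChartAt_symm_eq hy X
    have hY := mfderiv_extChartAt_symm_eq hy Y
    have hb : (extChartAt I p).symm (transition I p q y) = (extChartAt I q).symm y :=
      (extChartAt I p).left_inv hy.self_of_nhds.2
    -- Every tangent space is `E` by definition; a non-dependent type for the metric allows its base
    -- point to be rewritten.
    let b : N → E →L[ℝ] E →L[ℝ] ℝ := fun q => g q
    change b ((extChartAt I q).symm y) (mfderiv 𝓘(ℝ, E) I (extChartAt I q).symm y X : E)
      (mfderiv 𝓘(ℝ, E) I (extChartAt I q).symm y Y : E) = b _ _ _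
    rw [hX, hY, hb]
  · filter_upwards [hev] with y hy
    exact congrArg u ((extChartAt I p).left_inv hy.2).symm

theorem contDiffAt_comp_extChartAt_symm {u : N → ℝ} {p : N}
    (hu : ContMDiffAt I 𝓘(ℝ, ℝ) ∞ u p) :
    ContDiffAt ℝ ∞ (u ∘ (extChartAt I p).symm) (extChartAt I p p) := by
  have h := contMDiffAt_extChartAt_symm_of_mem (I := I) p (mem_extChartAt_target p)
  refine contMDiffAt_iff_contDiffAt.mp (ContMDiffAt.comp _ ?_ h)
  rwa [extChartAt_to_inv]

theorem contMDiffAt_laplacian [FiniteDimensional ℝ E]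
    {g : ∀ q : N, TangentSpace I q →L[ℝ] TangentSpace I q →L[ℝ] ℝ} {u : N → ℝ} {p : N}
    (hG : ContDiffAt ℝ ∞ (inChart I g p) (extChartAt I p p))
    (hg : ∀ᶠ q in 𝓝 p, (∀ X Y, g q X Y = g q Y X) ∧ ∀ X, (∀ Y, g q X Y = 0) → X = 0)
    (hu : ContMDiffAt I 𝓘(ℝ, ℝ) ∞ u p) :
    ContMDiffAt I 𝓘(ℝ, ℝ) ∞ (laplacian I g u) p := by
  have hu' := contDiffAt_comp_extChartAt_symm hu
  have hle : (2 : WithTop ℕ∞) ≤ ∞ := by norm_cast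
  have hle1 : (1 : WithTop ℕ∞) ≤ ∞ := by norm_cast
  have hc : ContinuousAt (extChartAt I p) p := continuousAt_extChartAt p
  have hinv : ∀ q ∈ (extChartAt I p).source, (∀ X, (∀ Y, g q X Y = 0) → X = 0) →
      (inChart I g p (extChartAt I p q)).IsInvertible := fun q hq h =>
    isInvertible_inChart p ((extChartAt I p).map_source hq) (by rwa [(extChartAt I p).left_inv hq])
  have hev : laplacian I g u =ᶠ[𝓝 p]
      coordLaplacian (inChart I g p) (u ∘ (extChartAt I p).symm) ∘ extChartAt I p := by
    filter_upwards [hg, extChartAt_source_mem_nhds (I := I) p,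
      hc.eventually ((hG.of_le hle1).eventually (by simp)),
      hc.eventually ((hu'.of_le hle).eventually (by simp))] with q h1 h2 h3 h4
    refine laplacian_eq_coordLaplacian h2 (h3.differentiableAt (by simp))
      (inChart_symm p ?_) (hinv q h2 h1.2) h4
    rw [(extChartAt I p).left_inv h2]
    exact h1.1
  refine ContMDiffAt.congr_of_eventuallyEq ?_ hev
  exact (contDiffAt_coordLaplacian hG (hinv p (mem_extChartAt_source p) hg.self_of_nhds.2)
    hu').contMDiffAt.comp p contMDiffAt_extChartAt

end ChartIndependence

/-! ### The ambient and Poincaré metrics in product charts. -/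

section ProductCharts

variable {n : ℕ} {M : Type*} [TopologicalSpace M] [ChartedSpace (EuclideanSpace ℝ (Fin n)) M]

theorem extChartAt_poincareModel (q : ℝ × M) (z : ℝ × EuclideanSpace ℝ (Fin n)) :
    (extChartAt (poincareModel n) q).symm z = (z.1, (extChartAt (𝓡 n) q.2).symm z.2) := by
  simp only [extChartAt_prod, extChartAt_model_space_eq_id, PartialEquiv.prod_symm,
    PartialEquiv.prod_coe, PartialEquiv.refl_symm, PartialEquiv.refl_coe, id]

theorem extChartAt_poincareModel_self (q : ℝ × M) :
    extChartAt (poincareModel n) q q = (q.1, extChartAt (𝓡 n) q.2 q.2) := by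
  simp only [extChartAt_prod, extChartAt_model_space_eq_id,
    PartialEquiv.prod_coe, PartialEquiv.refl_coe, id]

theorem extChartAt_ambientModel (p : ℝ × M × ℝ) (z : ℝ × EuclideanSpace ℝ (Fin n) × ℝ) :
    (extChartAt (ambientModel n) p).symm z =
      (z.1, (extChartAt (𝓡 n) p.2.1).symm z.2.1, z.2.2) := by
  simp only [extChartAt_prod, extChartAt_model_space_eq_id, PartialEquiv.prod_symm,
    PartialEquiv.prod_coe, PartialEquiv.refl_symm, PartialEquiv.refl_coe, id]

theorem extChartAt_ambientModel_self (p : ℝ × M × ℝ) :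
    extChartAt (ambientModel n) p p = (p.1, extChartAt (𝓡 n) p.2.1 p.2.1, p.2.2) := by
  simp only [extChartAt_prod, extChartAt_model_space_eq_id,
    PartialEquiv.prod_coe, PartialEquiv.refl_coe, id]

end ProductCharts

section MetricsInCharts

variable {n : ℕ} {M : Type*} [TopologicalSpace M] [ChartedSpace (EuclideanSpace ℝ (Fin n)) M]
  [IsManifold (𝓡 n) ∞ M] {g : PseudoRiemannianMetric n M} (A : StraightNormal g)

theorem inChart_poincareMetric (q : ℝ × M) {z : ℝ × EuclideanSpace ℝ (Fin n)}
    (hz : z.2 ∈ (extChartAt (𝓡 n) q.2).target) :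
    inChart (poincareModel n) A.poincareMetric q z =
      poincareForm z.1 (inChart (𝓡 n) (A.fam (-(z.1 ^ 2) / 2)) q.2 z.2) := by
  let V := EuclideanSpace ℝ (Fin n)
  have h1 : HasMFDerivAt 𝓘(ℝ, ℝ × V) 𝓘(ℝ, ℝ) (fun y : ℝ × V => y.1) z
      (ContinuousLinearMap.fst ℝ ℝ V) := hasFDerivAt_fst.hasMFDerivAt
  have h2 : HasMFDerivAt 𝓘(ℝ, ℝ × V) 𝓘(ℝ, V) (fun y : ℝ × V => y.2) z
      (ContinuousLinearMap.snd ℝ ℝ V) := hasFDerivAt_snd.hasMFDerivAt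
  have h3 := ((contMDiffAt_extChartAt_symm_of_mem q.2 hz).mdifferentiableAt
    (by simp)).hasMFDerivAt
  have h4 := (h1.prodMk (h3.comp z h2)).mfderiv
  have e : ((extChartAt (poincareModel n) q).symm : ℝ × V → ℝ × M) =
      fun y => (y.1, (extChartAt (𝓡 n) q.2).symm y.2) :=
    funext fun y => extChartAt_poincareModel q y
  refine ContinuousLinearMap.ext fun X => ContinuousLinearMap.ext fun Y => ?_
  rw [inChart_apply, e, poincareForm_apply]
  erw [h4]
  rfl

theorem inChart_ambientMetric (p : ℝ × M × ℝ) {z : ℝ × EuclideanSpace ℝ (Fin n) × ℝ}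
    (hz : z.2.1 ∈ (extChartAt (𝓡 n) p.2.1).target) :
    inChart (ambientModel n) A.ambientMetric p z =
      ambientForm z.1 z.2.2 (inChart (𝓡 n) (A.fam z.2.2) p.2.1 z.2.1) := by
  let V := EuclideanSpace ℝ (Fin n)
  have h1 : HasMFDerivAt 𝓘(ℝ, ℝ × V × ℝ) 𝓘(ℝ, ℝ) (fun y : ℝ × V × ℝ => y.1) z
      (ContinuousLinearMap.fst ℝ ℝ (V × ℝ)) := hasFDerivAt_fst.hasMFDerivAt
  have h2 : HasMFDerivAt 𝓘(ℝ, ℝ × V × ℝ) 𝓘(ℝ, V) (fun y : ℝ × V × ℝ => y.2.1) z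
      ((ContinuousLinearMap.fst ℝ V ℝ).comp (ContinuousLinearMap.snd ℝ ℝ (V × ℝ))) :=
    (hasFDerivAt_snd.fst).hasMFDerivAt
  have h2' : HasMFDerivAt 𝓘(ℝ, ℝ × V × ℝ) 𝓘(ℝ, ℝ) (fun y : ℝ × V × ℝ => y.2.2) z
      ((ContinuousLinearMap.snd ℝ V ℝ).comp (ContinuousLinearMap.snd ℝ ℝ (V × ℝ))) :=
    (hasFDerivAt_snd.snd).hasMFDerivAt
  have h3 := ((contMDiffAt_extChartAt_symm_of_mem p.2.1 hz).mdifferentiableAt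
    (by simp)).hasMFDerivAt
  have h4 := (h1.prodMk ((h3.comp z h2).prodMk h2')).mfderiv
  have e : ((extChartAt (ambientModel n) p).symm : ℝ × V × ℝ → ℝ × M × ℝ) =
      fun y => (y.1, (extChartAt (𝓡 n) p.2.1).symm y.2.1, y.2.2) :=
    funext fun y => extChartAt_ambientModel p y
  refine ContinuousLinearMap.ext fun X => ContinuousLinearMap.ext fun Y => ?_
  rw [inChart_apply, e, ambientForm_apply]
  erw [h4]
  rfl

/-- The family of metrics is smooth in the preferred charts. -/
theorem contDiffAt_inChart_fam {ρ : ℝ} (hρ : ρ ∈ Set.Ioo (-A.ε) A.ε) (x : M) :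
    ContDiffAt ℝ ∞ (fun z : ℝ × EuclideanSpace ℝ (Fin n) => inChart (𝓡 n) (A.fam z.1) x z.2)
      (ρ, extChartAt (𝓡 n) x x) := by
  let V := EuclideanSpace ℝ (Fin n)
  have : IsManifold (𝓡 n) 1 M := IsManifold.of_le (n := ∞) (by simp)
  have hs := (A.smooth (ρ, x) ⟨hρ, trivial⟩).contMDiffAt
    ((isOpen_Ioo.prod isOpen_univ).mem_nhds ⟨hρ, trivial⟩)
  have hs2 := (Bundle.contMDiffAt_totalSpace.mp hs).2
  have hmap : ContMDiffAt 𝓘(ℝ, ℝ × V) (𝓘(ℝ, ℝ).prod (𝓡 n)) ∞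
      (fun z : ℝ × V => (z.1, (extChartAt (𝓡 n) x).symm z.2)) (ρ, extChartAt (𝓡 n) x x) := by
    have h1 : ContMDiffAt 𝓘(ℝ, ℝ × V) 𝓘(ℝ, ℝ) ∞ (fun z : ℝ × V => z.1)
        (ρ, extChartAt (𝓡 n) x x) := contDiffAt_fst.contMDiffAt
    have h2 : ContMDiffAt 𝓘(ℝ, ℝ × V) 𝓘(ℝ, V) ∞ (fun z : ℝ × V => z.2)
        (ρ, extChartAt (𝓡 n) x x) := contDiffAt_snd.contMDiffAt
    exact h1.prodMk (ContMDiffAt.comp (I' := 𝓘(ℝ, V)) (g := (extChartAt (𝓡 n) x).symm)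
      (f := fun z : ℝ × V => z.2) _
      (contMDiffAt_extChartAt_symm_of_mem x (mem_extChartAt_target x)) h2)
  have hm0 : (fun z : ℝ × V => (z.1, (extChartAt (𝓡 n) x).symm z.2)) (ρ, extChartAt (𝓡 n) x x) =
      (ρ, x) := by simp
  have hcomp := contMDiffAt_iff_contDiffAt.mp (hs2.comp_of_eq hmap hm0)
  refine hcomp.congr_of_eventuallyEq ?_
  filter_upwards [(continuous_snd.tendsto _).eventually
    (extChartAt_target_mem_nhds (I := 𝓡 n) x)] with z hz
  have hsrc := (extChartAt (𝓡 n) x).map_target hz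
  rw [extChartAt_source] at hsrc
  -- Smoothness of the family is a statement about bundle trivializations, while `inChart` uses
  -- derivatives of the inverse chart. The inverse of the tangent trivialization at `x` is exactly
  -- that derivative, so both give the same matrix of the metric.
  have hL := TangentBundle.symmL_trivializationAt (I := 𝓡 n) hsrc
  rw [ModelWithCorners.range_eq_univ, mfderivWithin_univ, (extChartAt (𝓡 n) x).right_inv hz] at hL
  refine ContinuousLinearMap.ext fun X => ContinuousLinearMap.ext fun Y => ?_
  have hbase : (extChartAt (𝓡 n) x).symm z.2 ∈
      (trivializationAt V (TangentSpace (𝓡 n)) x).baseSet := by simpa using hsrc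
  have hsym : ∀ v : V, (trivializationAt V (TangentSpace (𝓡 n)) x).symm
      ((extChartAt (𝓡 n) x).symm z.2) v =
      mfderiv 𝓘(ℝ, V) (𝓡 n) (extChartAt (𝓡 n) x).symm z.2 v := fun v =>
    (Bundle.Trivialization.symmL_apply _ hbase v).symm.trans (congrArg (fun L : V →L[ℝ] V => L v) hL)
  symm
  simp only [Function.comp_apply, hom_trivializationAt_apply]
  rw [inCoordinates_apply_eq₂ hbase hbase (by simp)]
  simp only [Bundle.Trivial.fiberBundle_trivializationAt',
    Bundle.Trivial.linearMapAt_trivialization, LinearMap.id_apply]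
  exact congrArg₂ (fun X' Y' : V => A.fam z.1 ((extChartAt (𝓡 n) x).symm z.2) X' Y')
    (hsym X) (hsym Y)

end MetricsInCharts

/-! ### Homogeneous extensions from the Poincaré space and their ambient Laplacian. -/

theorem coneMap_rightInverse {M : Type*} {t ρ : ℝ} (x : M) (hρ : ρ < 0) :
    coneMap (t * √(-2 * ρ), √(-2 * ρ), x) = (t, x, ρ) := by
  have h : 0 < √(-2 * ρ) := Real.sqrt_pos.mpr (by linarith)
  have h2 : √(-2 * ρ) ^ 2 = -2 * ρ := Real.sq_sqrt (by linarith)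
  simp only [coneMap, h2]
  rw [mul_div_cancel_right₀ _ h.ne']
  ring_nf

theorem incl_eq_coneMap {M : Type*} (q : ℝ × M) : StraightNormal.incl q = coneMap (1, q) := by
  simp [StraightNormal.incl, coneMap]

namespace StraightNormal

variable {n : ℕ} {M : Type*} [TopologicalSpace M] [ChartedSpace (EuclideanSpace ℝ (Fin n)) M]
  [IsManifold (𝓡 n) ∞ M] {g : PseudoRiemannianMetric n M} (A : StraightNormal g)

theorem isOpen_poincareSpace : IsOpen A.poincareSpace :=
  (isOpen_lt continuous_const continuous_fst).inter
    (isOpen_lt ((continuous_fst.pow 2).div_const 2) continuous_const)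

theorem parameter_mem {r : ℝ} (h0 : r ≠ 0) (hr : r ^ 2 / 2 < A.ε) :
    -(r ^ 2) / 2 ∈ Set.Ioo (-A.ε) A.ε :=
  ⟨by linarith, by have := A.ε_pos; have : 0 < r ^ 2 := by positivity
                   linarith⟩

theorem poincareMetric_symm {q : ℝ × M} (hq : q ∈ A.poincareSpace)
    (X Y : TangentSpace (poincareModel n) q) :
    A.poincareMetric q X Y = A.poincareMetric q Y X := by
  obtain ⟨r, x⟩ := q
  have h := A.symm _ (A.parameter_mem hq.1.ne' hq.2) x X.2 Y.2
  have e := A.poincareMetric_apply r x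
  refine (e X.1 Y.1 X.2 Y.2).trans (Eq.trans ?_ (e Y.1 X.1 Y.2 X.2).symm)
  rw [h, mul_comm X.1]

theorem poincareMetric_nondegenerate {q : ℝ × M} (hq : q ∈ A.poincareSpace)
    (X : TangentSpace (poincareModel n) q) (hX : ∀ Y, A.poincareMetric q X Y = 0) : X = 0 := by
  obtain ⟨r, x⟩ := q
  have hr : r ≠ 0 := hq.1.ne'
  have e := A.poincareMetric_apply r x
  have h1 : X.1 = 0 := by
    have h := (e X.1 1 X.2 0).symm.trans (hX (1, 0))
    simpa [hr] using h
  have h2 : X.2 = 0 := by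
    refine A.nondegenerate _ (A.parameter_mem hr hq.2) x X.2 fun Y => ?_
    have h := (e X.1 0 X.2 Y).symm.trans (hX (0, Y))
    simpa [hr] using h
  exact Prod.ext h1 h2

theorem contDiffAt_inChart_poincareMetric {q : ℝ × M} (hq : q ∈ A.poincareSpace) :
    ContDiffAt ℝ ∞ (inChart (poincareModel n) A.poincareMetric q)
      (extChartAt (poincareModel n) q q) := by
  rw [extChartAt_poincareModel_self]
  have hev : inChart (poincareModel n) A.poincareMetric q =ᶠ[𝓝 (q.1, extChartAt (𝓡 n) q.2 q.2)]
      fun z => poincareForm z.1 (inChart (𝓡 n) (A.fam (-(z.1 ^ 2) / 2)) q.2 z.2) := by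
    filter_upwards [(continuous_snd.tendsto _).eventually
      (extChartAt_target_mem_nhds (I := 𝓡 n) q.2)] with z hz
    exact inChart_poincareMetric A q hz
  refine ContDiffAt.congr_of_eventuallyEq ?_ hev
  refine contDiffAt_poincareForm contDiffAt_fst hq.1.ne' ?_
  exact (contDiffAt_inChart_fam A (A.parameter_mem hq.1.ne' hq.2) q.2).comp
    (f := fun z : ℝ × EuclideanSpace ℝ (Fin n) => (-(z.1 ^ 2) / 2, z.2))
    (q.1, extChartAt (𝓡 n) q.2 q.2)
    ((((contDiffAt_fst.pow 2).neg).div_const 2).prodMk contDiffAt_snd)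

theorem contMDiffOn_poincareLaplacian {u : ℝ × M → ℝ}
    (hu : ContMDiffOn (poincareModel n) 𝓘(ℝ, ℝ) ∞ u A.poincareSpace) :
    ContMDiffOn (poincareModel n) 𝓘(ℝ, ℝ) ∞ (A.poincareLaplacian u) A.poincareSpace := by
  intro q hq
  have hn := A.isOpen_poincareSpace.mem_nhds hq
  refine (contMDiffAt_laplacian (A.contDiffAt_inChart_poincareMetric hq) ?_
    (hu.contMDiffAt hn)).contMDiffWithinAt
  filter_upwards [hn] with q' hq'
  exact ⟨A.poincareMetric_symm hq', A.poincareMetric_nondegenerate hq'⟩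

theorem poincareLaplacian_smul_add {u v : ℝ × M → ℝ} {q : ℝ × M} (hq : q ∈ A.poincareSpace)
    (hu : ContMDiffOn (poincareModel n) 𝓘(ℝ, ℝ) ∞ u A.poincareSpace)
    (hv : ContMDiffOn (poincareModel n) 𝓘(ℝ, ℝ) ∞ v A.poincareSpace) (c : ℝ) :
    A.poincareLaplacian (c • u + v) q =
      c * A.poincareLaplacian u q + A.poincareLaplacian v q := by
  have hn := A.isOpen_poincareSpace.mem_nhds hq
  have hle : (2 : WithTop ℕ∞) ≤ ∞ := by norm_cast
  exact coordLaplacian_smul_add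
    ((contDiffAt_comp_extChartAt_symm (hu.contMDiffAt hn)).of_le hle)
    ((contDiffAt_comp_extChartAt_symm (hv.contMDiffAt hn)).of_le hle) c

theorem poincareLaplacian_congr {u v : ℝ × M → ℝ} {q : ℝ × M} (hq : q ∈ A.poincareSpace)
    (h : Set.EqOn u v A.poincareSpace) : A.poincareLaplacian u q = A.poincareLaplacian v q := by
  refine coordLaplacian_congr EventuallyEq.rfl ?_
  have hc := (contMDiffAt_extChartAt_symm_of_mem (I := poincareModel n) q
    (mem_extChartAt_target q)).continuousAt
  rw [ContinuousAt, extChartAt_to_inv] at hc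
  filter_upwards [hc.eventually (A.isOpen_poincareSpace.mem_nhds hq)] with z hz
  exact h hz

/-- `u'` is, on the part of the ambient space where `ρ < 0`, the extension of homogeneity `w` of
the smooth function `u` on the Poincaré space. -/
def IsExtension (w : ℝ) (u' : ℝ × M × ℝ → ℝ) (u : ℝ × M → ℝ) : Prop :=
  ContMDiffOn (poincareModel n) 𝓘(ℝ, ℝ) ∞ u A.poincareSpace ∧
    ∀ q ∈ A.poincareSpace, ∀ s : ℝ, 0 < s → u' (coneMap (s, q)) = s ^ w * u q

variable {A}

theorem IsExtension.apply_incl {w : ℝ} {u' : ℝ × M × ℝ → ℝ} {u : ℝ × M → ℝ}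
    (h : A.IsExtension w u' u) {q : ℝ × M} (hq : q ∈ A.poincareSpace) : u' (incl q) = u q := by
  rw [incl_eq_coneMap, h.2 q hq 1 one_pos, Real.one_rpow, one_mul]

theorem IsExtension.mul {v w : ℝ} {f' u' : ℝ × M × ℝ → ℝ} {f u : ℝ × M → ℝ}
    (hf : A.IsExtension v f' f) (hu : A.IsExtension w u' u) :
    A.IsExtension (v + w) (fun p => f' p * u' p) (f * u) := by
  refine ⟨hf.1.mul hu.1, fun q hq s hs => ?_⟩
  change f' _ * u' _ = _
  rw [hf.2 q hq s hs, hu.2 q hq s hs, Real.rpow_add hs, Pi.mul_apply]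
  ring

theorem IsExtension.congr {w : ℝ} {u' : ℝ × M × ℝ → ℝ} {u v : ℝ × M → ℝ}
    (h : A.IsExtension w u' u) (huv : Set.EqOn u v A.poincareSpace) : A.IsExtension w u' v :=
  ⟨h.1.congr fun _ hq => (huv hq).symm, fun q hq s hs => by rw [h.2 q hq s hs, huv hq]⟩

theorem incl_mem_space {q : ℝ × M} (hq : q ∈ A.poincareSpace) : incl q ∈ A.space :=
  ⟨inv_pos.mpr hq.1, A.parameter_mem hq.1.ne' hq.2⟩

/-- The point `coneMap (s, q)` is the dilation by `s` of `incl q`. -/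
theorem isExtension_of_homogeneous {w : ℝ} {u : ℝ × M × ℝ → ℝ} (hu : u ∈ A.Homogeneous w) :
    A.IsExtension w u fun q => u (incl q) := by
  constructor
  · refine hu.1.comp (f := incl) ?_ fun q hq => incl_mem_space hq
    intro q hq
    have h1 : ContMDiffAt (poincareModel n) 𝓘(ℝ, ℝ) ∞ (fun q : ℝ × M => q.1) q := contMDiffAt_fst
    have h2 : ContMDiffAt (poincareModel n) (𝓡 n) ∞ (fun q : ℝ × M => q.2) q := contMDiffAt_snd
    have h3 : ContMDiffAt (poincareModel n) 𝓘(ℝ, ℝ) ∞ (fun q : ℝ × M => (q.1)⁻¹) q :=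
      ContMDiffAt.comp (I' := 𝓘(ℝ, ℝ)) (g := fun r : ℝ => r⁻¹) (f := fun q : ℝ × M => q.1) q
        ((contDiffAt_inv ℝ hq.1.ne').contMDiffAt) h1
    have h4 : ContMDiffAt (poincareModel n) 𝓘(ℝ, ℝ) ∞ (fun q : ℝ × M => -(q.1 ^ 2) / 2) q :=
      ContMDiffAt.comp (I' := 𝓘(ℝ, ℝ)) (g := fun r : ℝ => -(r ^ 2) / 2)
        (f := fun q : ℝ × M => q.1) q
        ((((contDiffAt_id.pow 2).neg).div_const 2).contMDiffAt) h1
    exact (h3.prodMk (h2.prodMk h4)).contMDiffWithinAt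
  · intro q hq s hs
    have h := hu.2 (incl q) (incl_mem_space hq) s hs
    rw [← h]
    simp [incl, coneMap, div_eq_mul_inv]

/-- `IsExtension` assumes smoothness only on the Poincaré space. Smoothness of `u'` where `ρ < 0`
follows by writing it as `s ^ w * u` in the coordinates `(s, r, x)`, so the Laplacian can be
iterated without further hypotheses. -/
theorem contDiffAt_ambient_comp_chart {w : ℝ} {u' : ℝ × M × ℝ → ℝ} {u : ℝ × M → ℝ}
    (h : A.IsExtension w u' u) {q : ℝ × M} (hq : q ∈ A.poincareSpace) {s : ℝ} (hs : 0 < s) :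
    ContDiffAt ℝ ∞ (u' ∘ (extChartAt (ambientModel n) (coneMap (s, q))).symm)
      (coneMap (s, q.1, extChartAt (𝓡 n) q.2 q.2)) := by
  let V := EuclideanSpace ℝ (Fin n)
  obtain ⟨r, x⟩ := q
  have hr : 0 < r := hq.1
  set y := extChartAt (𝓡 n) x x with hy
  -- The inverse of `coneMap`: `r = √(-2ρ)`, `s = r t`. It is smooth because `ρ < 0` here.
  let ψ : ℝ × V × ℝ → ℝ × ℝ × V := fun z => (z.1 * √(-2 * z.2.2), √(-2 * z.2.2), z.2.1)
  have hsq : √(-2 * (-(r ^ 2) / 2)) = r := by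
    rw [show -2 * (-(r ^ 2) / 2) = r ^ 2 by ring, Real.sqrt_sq hr.le]
  have hψ0 : ψ (coneMap (s, r, y)) = (s, r, y) := by
    simp only [ψ, coneMap, hsq]
    rw [div_mul_cancel₀ _ hr.ne']
  have hρ : (coneMap (s, r, y)).2.2 < 0 := by
    change -(r ^ 2) / 2 < 0
    have : 0 < r ^ 2 := by positivity
    linarith
  have hψ : ContDiffAt ℝ ∞ ψ (coneMap (s, r, y)) := by
    have h1 : ContDiffAt ℝ ∞ (fun z : ℝ × V × ℝ => √(-2 * z.2.2)) (coneMap (s, r, y)) :=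
      (contDiffAt_const.mul contDiffAt_snd.snd).sqrt (by linarith)
    exact (contDiffAt_fst.mul h1).prodMk (h1.prodMk contDiffAt_snd.fst)
  let U : ℝ × ℝ × V → ℝ := fun z =>
    z.1 ^ w * (u ∘ (extChartAt (poincareModel n) (r, x)).symm) z.2
  have hu := contDiffAt_comp_extChartAt_symm
    (h.1.contMDiffAt (A.isOpen_poincareSpace.mem_nhds hq))
  rw [extChartAt_poincareModel_self] at hu
  have hU : ContDiffAt ℝ ∞ U (ψ (coneMap (s, r, y))) := by
    rw [hψ0]
    exact (contDiffAt_fst.rpow_const_of_ne hs.ne').mul (ContDiffAt.comp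
      (g := u ∘ (extChartAt (poincareModel n) (r, x)).symm) (f := fun z : ℝ × ℝ × V => z.2)
      (s, r, y) hu contDiffAt_snd)
  refine (hU.comp _ hψ).congr_of_eventuallyEq ?_
  have hc : ContinuousAt (fun z : ℝ × ℝ × V =>
      (extChartAt (poincareModel n) (r, x)).symm z.2) (ψ (coneMap (s, r, y))) := by
    rw [hψ0]
    have h1 := (contMDiffAt_extChartAt_symm_of_mem (I := poincareModel n) (r, x)
      (mem_extChartAt_target (r, x))).continuousAt
    rw [extChartAt_poincareModel_self] at h1
    exact h1.comp (f := fun z : ℝ × ℝ × V => z.2) (x := (s, r, y)) continuousAt_snd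
  have hc2 := hc.comp hψ.continuousAt
  have hmem : ∀ᶠ z in 𝓝 (coneMap (s, r, y)),
      (extChartAt (poincareModel n) (r, x)).symm (ψ z).2 ∈ A.poincareSpace := by
    refine hc2.eventually (A.isOpen_poincareSpace.mem_nhds ?_)
    simp only [Function.comp_apply, hψ0]
    rw [extChartAt_poincareModel]
    simpa [hy] using hq
  have hpos : ∀ᶠ z in 𝓝 (coneMap (s, r, y)), 0 < (ψ z).1 := by
    refine (continuous_fst.continuousAt.comp hψ.continuousAt).eventually (lt_mem_nhds ?_)
    simpa [hψ0] using hs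
  filter_upwards [hmem, hpos,
    (continuous_snd.snd.tendsto (coneMap (s, r, y))).eventually (gt_mem_nhds hρ)] with z h1 h2 h3
  have e := h.2 _ h1 _ h2
  refine Eq.trans ?_ e
  rw [Function.comp_apply, extChartAt_ambientModel, extChartAt_poincareModel]
  exact congrArg u' (coneMap_rightInverse _ h3).symm

/-- The ambient Laplacian of a homogeneous extension. -/
theorem IsExtension.ambientLaplacian_apply {w : ℝ} {u' : ℝ × M × ℝ → ℝ} {u : ℝ × M → ℝ}
    (h : A.IsExtension w u' u) {q : ℝ × M} (hq : q ∈ A.poincareSpace) {s : ℝ} (hs : 0 < s) :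
    A.ambientLaplacian u' (coneMap (s, q)) =
      s ^ (w - 2) * (A.poincareLaplacian u q - w * (n + w) * u q) := by
  have hu' := contDiffAt_ambient_comp_chart h hq hs
  obtain ⟨r, x⟩ := q
  have hr : 0 < r := hq.1
  have hρ := A.parameter_mem hr.ne' hq.2
  have hle : (2 : WithTop ℕ∞) ≤ ∞ := by norm_cast
  let V := EuclideanSpace ℝ (Fin n)
  let k : ℝ → V → V →L[ℝ] V →L[ℝ] ℝ := fun ρ => inChart (𝓡 n) (A.fam ρ) x
  let G : ℝ × V → ℝ × V →L[ℝ] ℝ × V →L[ℝ] ℝ := fun z => poincareForm z.1 (k (-(z.1 ^ 2) / 2) z.2)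
  let U : ℝ × V → ℝ := u ∘ (extChartAt (poincareModel n) (r, x)).symm
  have hchart : extChartAt (ambientModel n) (coneMap (s, r, x)) (coneMap (s, r, x)) =
      coneMap (s, r, extChartAt (𝓡 n) x x) := extChartAt_ambientModel_self _
  set y := extChartAt (𝓡 n) x x with hy
  have hU : ContDiffAt ℝ ∞ U (r, y) := by
    have := contDiffAt_comp_extChartAt_symm
      (h.1.contMDiffAt (A.isOpen_poincareSpace.mem_nhds hq))
    rwa [extChartAt_poincareModel_self] at this
  have hGev : inChart (poincareModel n) A.poincareMetric (r, x) =ᶠ[𝓝 (r, y)] G := by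
    filter_upwards [(continuous_snd.tendsto (r, y)).eventually
      (extChartAt_target_mem_nhds (I := 𝓡 n) x)] with z hz
    exact inChart_poincareMetric A (r, x) hz
  have hGsmooth : ContDiffAt ℝ ∞ G (r, y) := by
    have := A.contDiffAt_inChart_poincareMetric hq
    rw [extChartAt_poincareModel_self] at this
    exact this.congr_of_eventuallyEq hGev.symm
  have hleft : (extChartAt (𝓡 n) x).symm y = x := extChartAt_to_inv x
  have hinvk : (k (-(r ^ 2) / 2) y).IsInvertible := by
    refine isInvertible_inChart x (mem_extChartAt_target x) ?_
    rw [extChartAt_to_inv]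
    exact A.nondegenerate _ hρ x
  have hsymmk : ∀ X Y, k (-(r ^ 2) / 2) y X Y = k (-(r ^ 2) / 2) y Y X := by
    refine inChart_symm x ?_
    rw [hleft]
    exact A.symm _ hρ x
  have hcone := coordLaplacian_coneMetric (G := G) (p := (s, r, y)) hs
    (hGsmooth.differentiableAt (by simp)) (isInvertible_poincareForm hr.ne' hinvk)
    (fun X Y => by simp only [G, poincareForm_apply, hsymmk X.2, mul_comm X.1])
    (hU.of_le hle) w
  have hAev : inChart (ambientModel n) A.ambientMetric (coneMap (s, r, x))
      =ᶠ[𝓝 (coneMap (s, r, y))] fun z => ambientForm z.1 z.2.2 (k z.2.2 z.2.1) := by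
    filter_upwards [(continuous_snd.fst.tendsto (coneMap (s, r, y))).eventually
      (extChartAt_target_mem_nhds (I := 𝓡 n) x)] with z hz
    exact inChart_ambientMetric A (coneMap (s, r, x)) hz
  have hAsmooth : ContDiffAt ℝ ∞
      (fun z : ℝ × V × ℝ => ambientForm z.1 z.2.2 (k z.2.2 z.2.1)) (coneMap (s, r, y)) := by
    refine contDiffAt_ambientForm contDiffAt_fst contDiffAt_snd.snd ?_
    exact (contDiffAt_inChart_fam A hρ x).comp
      (f := fun z : ℝ × V × ℝ => (z.2.2, z.2.1)) (coneMap (s, r, y))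
      (contDiffAt_snd.snd.prodMk contDiffAt_snd.fst)
  -- Naturality under `coneMap` replaces the ambient metric by `coneMetric G` and `u'` by the
  -- explicit `s ^ w * U`, to which `hcone` applies.
  have hpull := coordLaplacian_pullback
    (G := fun z : ℝ × V × ℝ => ambientForm z.1 z.2.2 (k z.2.2 z.2.1)) (G' := coneMetric G)
    (ψ := coneMap) (z := (s, r, y))
    (u := u' ∘ (extChartAt (ambientModel n) (coneMap (s, r, x))).symm)
    (u' := fun z => z.1 ^ w * U z.2)
    (contDiffAt_coneMap hr.ne') (isInvertible_fderiv_coneMap hr.ne')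
    (hAsmooth.differentiableAt (by simp))
    (fun X Y => by
      simp only [ambientForm_apply]
      rw [show k (coneMap (s, r, y)).2.2 (coneMap (s, r, y)).2.1 X.2.1 Y.2.1 =
        k (coneMap (s, r, y)).2.2 (coneMap (s, r, y)).2.1 Y.2.1 X.2.1 from hsymmk _ _]
      ring)
    (isInvertible_ambientForm (div_pos hs hr).ne' _ hinvk) (hu'.of_le hle)
    (by
      filter_upwards [(continuous_snd.fst.tendsto (s, r, y)).eventually (lt_mem_nhds hr)] with z hz
      exact coneMetric_eq_pullback k hz.ne')
    (by
      have hc := (contMDiffAt_extChartAt_symm_of_mem (I := poincareModel n) (r, x)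
        (mem_extChartAt_target (r, x))).continuousAt
      rw [ContinuousAt, extChartAt_to_inv, extChartAt_poincareModel_self] at hc
      have hc' := hc.comp (continuous_snd.tendsto (s, r, y))
      filter_upwards [hc'.eventually (A.isOpen_poincareSpace.mem_nhds hq),
        (continuous_fst.tendsto (s, r, y)).eventually (lt_mem_nhds hs)] with z h1 h2
      have e := h.2 _ h1 _ h2
      refine e.symm.trans ?_
      rw [Function.comp_apply, Function.comp_apply, Function.comp_apply, extChartAt_ambientModel,
        extChartAt_poincareModel]
      rfl)
  have hamb : A.ambientLaplacian u' (coneMap (s, r, x)) =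
      coordLaplacian (coneMetric G) (fun z => z.1 ^ w * U z.2) (s, r, y) := by
    rw [hpull]
    simp only [ambientLaplacian, laplacian]
    rw [hchart]
    exact coordLaplacian_congr hAev EventuallyEq.rfl
  have hpoin : A.poincareLaplacian u (r, x) = coordLaplacian G U (r, y) := by
    simp only [poincareLaplacian, laplacian]
    rw [extChartAt_poincareModel_self]
    exact coordLaplacian_congr hGev EventuallyEq.rfl
  have hUx : U (r, y) = u (r, x) := by
    simp only [U, Function.comp_apply]
    rw [extChartAt_poincareModel, hleft]
  rw [hamb, hcone, hpoin, hUx]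
  -- The cross-section has dimension `n + 1`, which turns `w (w + dim - 1)` into `w (n + w)`.
  have hV : Module.finrank ℝ V = n := finrank_euclideanSpace_fin
  rw [Module.finrank_prod, Module.finrank_self, hV]
  push_cast
  ring

theorem IsExtension.ambientLaplacian {w : ℝ} {u' : ℝ × M × ℝ → ℝ} {u : ℝ × M → ℝ}
    (h : A.IsExtension w u' u) :
    A.IsExtension (w - 2) (A.ambientLaplacian u')
      (A.poincareLaplacian u - (w * (n + w)) • u) :=
  ⟨(A.contMDiffOn_poincareLaplacian h.1).sub
    (contMDiffOn_const.mul h.1 : ContMDiffOn _ _ _ (fun q => (w * (n + w)) * u q) _),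
    fun _ hq _ hs => h.ambientLaplacian_apply hq hs⟩

end StraightNormal

/-! ### Expansion of `∏_{i=1}^m (T - λ_i)` in the products `∏_{l<i} (T - λ_l)`. -/

section ProductExpansion

variable {V : Type*} [AddCommGroup V] [Module ℝ V]

/-- The eigenvalue `(w - 2i)(n + w - 2i)`. -/
noncomputable def shift (n : ℕ) (w : ℝ) (i : ℕ) : ℝ := (w - 2 * i) * (n + w - 2 * i)

/-- The product `∏_{i=0}^{j-1} (T - shift i)`. -/
noncomputable def lowerProduct (T : Module.End ℝ V) (n : ℕ) (w : ℝ) : ℕ → Module.End ℝ V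
  | 0 => 1
  | j + 1 => (T - shift n w j • 1) * lowerProduct T n w j

/-- The product `∏_{i=1}^{m} (T - shift i)`. -/
noncomputable def upperProduct (T : Module.End ℝ V) (n : ℕ) (w : ℝ) : ℕ → Module.End ℝ V
  | 0 => 1
  | m + 1 => upperProduct T n w m * (T - shift n w (m + 1) • 1)

theorem commute_lowerProduct (T : Module.End ℝ V) (n : ℕ) (w c : ℝ) (j : ℕ) :
    Commute (T - c • 1) (lowerProduct T n w j) := by
  have h : ∀ d : ℝ, Commute (T - c • 1) (T - d • 1) := fun d =>
    ((Commute.refl T).sub_right ((Commute.one_right T).smul_right d)).sub_left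
      (((Commute.one_left T).sub_right ((Commute.one_left 1).smul_right d)).smul_left c)
  induction j with
  | zero => exact Commute.one_right _
  | succ j ih => exact (h _).mul_right ih

/-- The coefficients of the expansion of `upperProduct` in terms of `lowerProduct`. -/
noncomputable def expansionCoeff (n : ℕ) (w : ℝ) (m i : ℕ) : ℝ :=
  4 ^ (m - i) * ((m.factorial : ℝ) / i.factorial) * gammaRatio (n / 2 + w - m) (m - i)

theorem gammaRatio_succ (x : ℝ) (m : ℕ) : gammaRatio x (m + 1) = gammaRatio x m * (x + m) :=
  Finset.prod_range_succ _ _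

theorem gammaRatio_succ' (x : ℝ) (m : ℕ) : gammaRatio x (m + 1) = x * gammaRatio (x + 1) m := by
  simp only [gammaRatio]
  rw [Finset.prod_range_succ', mul_comm]
  congr 1
  · simp
  · refine Finset.prod_congr rfl fun l _ => ?_
    push_cast
    ring

theorem gammaRatio_add (x : ℝ) (l m : ℕ) :
    gammaRatio x (l + m) = gammaRatio x l * gammaRatio (x + l) m := by
  simp only [gammaRatio]
  rw [Finset.prod_range_add]
  congr 1
  refine Finset.prod_congr rfl fun i _ => ?_
  push_cast
  ring

theorem expansionCoeff_self (n : ℕ) (w : ℝ) (m : ℕ) : expansionCoeff n w m m = 1 := by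
  have : (m.factorial : ℝ) ≠ 0 := by exact_mod_cast m.factorial_ne_zero
  simp [expansionCoeff, gammaRatio, this]

theorem expansionCoeff_succ_zero (n : ℕ) (w : ℝ) (m : ℕ) :
    expansionCoeff n w (m + 1) 0 =
      (shift n w 0 - shift n w (m + 1)) * expansionCoeff n w m 0 := by
  simp only [expansionCoeff, shift, Nat.sub_zero, Nat.factorial_succ]
  rw [gammaRatio_succ']
  push_cast
  rw [show (n / 2 + w - (m + 1) + 1 : ℝ) = n / 2 + w - m by ring]
  ring

/-- Put `x = n/2 + w - (m + 1)` and `l = m - i - 1`. Then `λ_{i+1} - λ_{m+1} = 4 (l + 1)(x - i -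
1)`, and after removal of common factors the claim is `(m + 1) x = (i + 1)(x + 1 + l) + (l + 1)(x -
i - 1)`. -/
theorem expansionCoeff_succ_succ (n : ℕ) (w : ℝ) {m i : ℕ} (hi : i < m) :
    expansionCoeff n w (m + 1) (i + 1) = expansionCoeff n w m i +
      (shift n w (i + 1) - shift n w (m + 1)) * expansionCoeff n w m (i + 1) := by
  obtain ⟨l, rfl⟩ := Nat.exists_eq_add_of_lt hi
  simp only [expansionCoeff, shift, show i + l + 1 + 1 - (i + 1) = l + 1 by lia,
    show i + l + 1 - i = l + 1 by lia, show i + l + 1 - (i + 1) = l by lia]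
  have hf : (i.factorial : ℝ) ≠ 0 := by exact_mod_cast i.factorial_ne_zero
  rw [gammaRatio_succ', gammaRatio_succ, Nat.factorial_succ (i + l + 1), Nat.factorial_succ i]
  push_cast
  rw [show (n / 2 + w - (i + l + 1 + 1) + 1 : ℝ) = n / 2 + w - (i + l + 1) by ring]
  field_simp
  ring

theorem upperProduct_eq_sum (T : Module.End ℝ V) (n : ℕ) (w : ℝ) (m : ℕ) :
    upperProduct T n w m =
      ∑ i ∈ Finset.range (m + 1), expansionCoeff n w m i • lowerProduct T n w i := by
  induction m with
  | zero => simp [upperProduct, lowerProduct, expansionCoeff_self]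
  | succ m ih =>
    -- Writing `T - λ_{m+1} = (T - λ_i) + (λ_i - λ_{m+1})` either lengthens the lower product or
    -- rescales it; this is the source of the recursion for `expansionCoeff`.
    have hstep : ∀ i, lowerProduct T n w i * (T - shift n w (m + 1) • 1) =
        lowerProduct T n w (i + 1) +
          (shift n w i - shift n w (m + 1)) • lowerProduct T n w i := by
      intro i
      rw [← (commute_lowerProduct T n w _ i).eq, lowerProduct, sub_mul, sub_mul, sub_smul,
        smul_mul_assoc, smul_mul_assoc, one_mul]
      abel
    have hsucc : ∑ i ∈ Finset.range m,
        expansionCoeff n w (m + 1) (i + 1) • lowerProduct T n w (i + 1) =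
        ∑ i ∈ Finset.range m, expansionCoeff n w m i • lowerProduct T n w (i + 1) +
        ∑ i ∈ Finset.range m, ((shift n w (i + 1) - shift n w (m + 1)) *
          expansionCoeff n w m (i + 1)) • lowerProduct T n w (i + 1) := by
      rw [← Finset.sum_add_distrib]
      refine Finset.sum_congr rfl fun i hi => ?_
      rw [expansionCoeff_succ_succ n w (Finset.mem_range.mp hi), add_smul]
    rw [upperProduct, ih, Finset.sum_mul, Finset.sum_congr rfl fun i _ => by
      rw [smul_mul_assoc, hstep, smul_add, smul_smul], Finset.sum_add_distrib,
      Finset.sum_range_succ (fun i => expansionCoeff n w m i • lowerProduct T n w (i + 1)),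
      Finset.sum_range_succ' (fun i =>
        (expansionCoeff n w m i * (shift n w i - shift n w (m + 1))) • lowerProduct T n w i),
      Finset.sum_range_succ (fun i => expansionCoeff n w (m + 1) i • lowerProduct T n w i),
      Finset.sum_range_succ' (fun i => expansionCoeff n w (m + 1) i • lowerProduct T n w i),
      expansionCoeff_self, expansionCoeff_self, expansionCoeff_succ_zero,
      hsucc]
    simp only [mul_comm (expansionCoeff n w m _)]
    abel

/-- With `x = n/2 + w - k`, the relation on weights turns the first Gamma quotient of `a_j` into the
rising product of length `j` from `x`. The one in `expansionCoeff` continues it from `x + j`, so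
together they have length `k - i`. The second quotient of `a_j` already has length `k - j`, and the
factor `(k - j)!` cancels. -/
theorem coeffA_mul_expansionCoeff {n k : ℕ} {v w : ℝ} (hw : w = -(n + v - 2 * k) / 2) {i j : ℕ}
    (h : i + j ≤ k) :
    coeffA n k w v j * expansionCoeff n w (k - j) i = coeffC n k w i j := by
  obtain ⟨l, rfl⟩ := Nat.exists_eq_add_of_le h
  have hx : ((i + j + l : ℕ) - w - v - n / 2 : ℝ) = n / 2 + w - (i + j + l : ℕ) := by
    rw [hw]
    ring
  simp only [coeffA, expansionCoeff, coeffC]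
  rw [hx, show i + j + l - j = i + l by lia, show i + l - i = l by lia,
    show i + j + l - i = j + l by lia, show j + l - j = l by lia, gammaRatio_add _ j l,
    Nat.choose_eq_factorial_div_factorial (show j ≤ i + j + l by lia),
    Nat.cast_div (Nat.factorial_mul_factorial_dvd_factorial (show j ≤ i + j + l by lia))
      (by positivity), show i + j + l - j = i + l by lia]
  push_cast
  rw [show (n / 2 + w - (i + j + l) + j : ℝ) = n / 2 + w - (i + l) by ring]
  have h1 : (i.factorial : ℝ) ≠ 0 := by exact_mod_cast i.factorial_ne_zero
  have h2 : (j.factorial : ℝ) ≠ 0 := by exact_mod_cast j.factorial_ne_zero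
  have h3 : ((i + l).factorial : ℝ) ≠ 0 := by exact_mod_cast (i + l).factorial_ne_zero
  field_simp

theorem coeffC_symm (n k : ℕ) (w : ℝ) (i j : ℕ) : coeffC n k w i j = coeffC n k w j i := by
  simp only [coeffC, show k - i - j = k - j - i by lia]
  ring

theorem coeffC_eq_Gamma {n k : ℕ} {v w : ℝ} (hw : w = -(n + v - 2 * k) / 2)
    (hv : ∀ l : ℕ, v ≠ 2 * l) {i j : ℕ} (h : i + j ≤ k) :
    coeffC n k w i j =
      4 ^ (k - i - j) * ((k.factorial : ℝ) / (i.factorial * j.factorial)) *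
        (Real.Gamma (n / 2 + w - i) * Real.Gamma (n / 2 + w - j) /
          Real.Gamma (n / 2 + w - k) ^ 2) := by
  -- The relation on weights gives `n/2 + w - k = -v/2`.
  have hx : ∀ l : ℕ, (n / 2 + w - k : ℝ) ≠ -l := fun l hl => hv l (by linarith)
  rw [coeffC, gammaRatio_eq hx, gammaRatio_eq hx, Nat.cast_sub (by lia), Nat.cast_sub (by lia),
    show (n / 2 + w - k + (k - i) : ℝ) = n / 2 + w - i by ring,
    show (n / 2 + w - k + (k - j) : ℝ) = n / 2 + w - j by ring]
  ring

end ProductExpansion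

/-! ### Iterated ambient Laplacians as products of operators on the Poincaré space. -/

namespace StraightNormal

variable {n : ℕ} {M : Type*} [TopologicalSpace M] [ChartedSpace (EuclideanSpace ℝ (Fin n)) M]
  [IsManifold (𝓡 n) ∞ M] {g : PseudoRiemannianMetric n M} (A : StraightNormal g)

/-- The smooth functions on the Poincaré space, extended by zero. -/
def smoothFunctions : Submodule ℝ (ℝ × M → ℝ) where
  carrier := {F | ContMDiffOn (poincareModel n) 𝓘(ℝ, ℝ) ∞ F A.poincareSpace ∧
    ∀ q ∉ A.poincareSpace, F q = 0}
  zero_mem' := ⟨contMDiffOn_const, fun _ _ => rfl⟩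
  add_mem' := fun hF hG => ⟨hF.1.add hG.1, fun q hq => by simp [hF.2 q hq, hG.2 q hq]⟩
  smul_mem' := fun c F hF =>
    ⟨(contMDiffOn_const.mul hF.1 : ContMDiffOn _ _ _ (fun q => c * F q) _),
      fun q hq => by simp [hF.2 q hq]⟩

/-- The restriction of a smooth function to the Poincaré space. -/
noncomputable def restrict (F : ℝ × M → ℝ)
    (hF : ContMDiffOn (poincareModel n) 𝓘(ℝ, ℝ) ∞ F A.poincareSpace) : A.smoothFunctions :=
  ⟨A.poincareSpace.indicator F, hF.congr fun _ hq => Set.indicator_of_mem hq F,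
    fun _ hq => Set.indicator_of_notMem hq F⟩

theorem restrict_apply {F : ℝ × M → ℝ}
    (hF : ContMDiffOn (poincareModel n) 𝓘(ℝ, ℝ) ∞ F A.poincareSpace) {q : ℝ × M}
    (hq : q ∈ A.poincareSpace) : (A.restrict F hF).1 q = F q :=
  Set.indicator_of_mem hq F

variable {A} in
-- Extension by zero makes agreement on the Poincaré space into equality. Together with smoothness,
-- which linearity of the Laplacian needs, this lets `laplacianEnd` be an element of an endomorphism
-- algebra.
theorem smoothFunctions_ext {F G : A.smoothFunctions} (h : Set.EqOn F.1 G.1 A.poincareSpace) :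
    F = G := by
  refine Subtype.ext (funext fun q => ?_)
  by_cases hq : q ∈ A.poincareSpace
  · exact h hq
  · rw [F.2.2 q hq, G.2.2 q hq]

/-- The Laplacian of the Poincaré metric on smooth functions. -/
noncomputable def laplacianEnd : Module.End ℝ A.smoothFunctions where
  toFun F := A.restrict (A.poincareLaplacian F.1) (A.contMDiffOn_poincareLaplacian F.2.1)
  map_add' F G := smoothFunctions_ext fun q hq => by
    have h := A.poincareLaplacian_smul_add hq F.2.1 G.2.1 1
    rw [one_smul, one_mul] at h
    rw [restrict_apply _ _ hq]
    refine h.trans ?_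
    rw [← A.restrict_apply (A.contMDiffOn_poincareLaplacian F.2.1) hq,
      ← A.restrict_apply (A.contMDiffOn_poincareLaplacian G.2.1) hq]
    rfl
  map_smul' c F := smoothFunctions_ext fun q hq => by
    -- Additivity at `0 + 0` gives that the Laplacian of `0` vanishes.
    have h0 := A.poincareLaplacian_smul_add hq (0 : A.smoothFunctions).2.1
      (0 : A.smoothFunctions).2.1 1
    have h := A.poincareLaplacian_smul_add hq F.2.1 (0 : A.smoothFunctions).2.1 c
    simp only [Submodule.coe_zero, smul_zero, add_zero, one_mul, left_eq_add] at h0 h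
    rw [restrict_apply _ _ hq]
    refine h.trans ?_
    rw [h0, add_zero, ← A.restrict_apply (A.contMDiffOn_poincareLaplacian F.2.1) hq]
    rfl

theorem laplacianEnd_apply (F : A.smoothFunctions) {q : ℝ × M} (hq : q ∈ A.poincareSpace) :
    (A.laplacianEnd F).1 q = A.poincareLaplacian F.1 q :=
  A.restrict_apply (A.contMDiffOn_poincareLaplacian F.2.1) hq

theorem poincareOperator_eq {w : ℝ} {F : ℝ × M → ℝ} {G : A.smoothFunctions}
    (h : Set.EqOn F G.1 A.poincareSpace) (j : ℕ) :
    Set.EqOn (A.poincareOperator w j F) (lowerProduct A.laplacianEnd n w j G).1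
      A.poincareSpace := by
  induction j with
  | zero => exact h
  | succ j ih =>
    intro q hq
    have e : (lowerProduct A.laplacianEnd n w (j + 1) G).1 q =
        (A.laplacianEnd (lowerProduct A.laplacianEnd n w j G)).1 q -
          shift n w j * (lowerProduct A.laplacianEnd n w j G).1 q := rfl
    rw [e, A.laplacianEnd_apply _ hq, ← A.poincareLaplacian_congr hq ih, ← ih hq]
    rfl

variable {A}

theorem IsExtension.laplacian_sub {w c : ℝ} {u' : ℝ × M × ℝ → ℝ} {F : A.smoothFunctions}
    (h : A.IsExtension w u' F.1) (hc : w * (n + w) = c) :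
    A.IsExtension (w - 2) (A.ambientLaplacian u') ((A.laplacianEnd - c • 1) F).1 := by
  refine h.ambientLaplacian.congr fun q hq => ?_
  rw [hc]
  have e : ((A.laplacianEnd - c • 1) F).1 q = (A.laplacianEnd F).1 q - c * F.1 q := rfl
  rw [e, A.laplacianEnd_apply _ hq]
  rfl

theorem IsExtension.iterate_lower {w : ℝ} {u' : ℝ × M × ℝ → ℝ} {F : A.smoothFunctions}
    (h : A.IsExtension w u' F.1) (j : ℕ) :
    A.IsExtension (w - 2 * j) (A.ambientLaplacian^[j] u')
      (lowerProduct A.laplacianEnd n w j F).1 := by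
  induction j with
  | zero => simpa [lowerProduct] using h
  | succ j ih =>
    rw [Function.iterate_succ_apply']
    have := ih.laplacian_sub (c := shift n w j) (by rw [shift]; ring)
    rw [show w - 2 * (j : ℝ) - 2 = w - 2 * (j + 1 : ℕ) by push_cast; ring] at this
    exact this

/-- The weights run through `2i - n - w` for `i = m, …, 1`, and `ω (n + ω)` at `ω = 2i - n - w`
equals `λ_i`. The factor with index `m` acts first, which is why `upperProduct` grows on the right.
-/
theorem IsExtension.iterate_upper {w : ℝ} (m : ℕ) {u' : ℝ × M × ℝ → ℝ} {F : A.smoothFunctions}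
    (h : A.IsExtension (2 * m - n - w) u' F.1) :
    A.IsExtension (-n - w) (A.ambientLaplacian^[m] u')
      (upperProduct A.laplacianEnd n w m F).1 := by
  induction m generalizing u' F with
  | zero => simpa [upperProduct] using h
  | succ m ih =>
    rw [Function.iterate_succ_apply]
    have := h.laplacian_sub (c := shift n w (m + 1)) (by rw [shift]; push_cast; ring)
    rw [show 2 * ((m + 1 : ℕ) : ℝ) - n - w - 2 = 2 * m - n - w by push_cast; ring] at this
    exact ih this

end StraightNormal

end PoincareExpansion

open PoincareExpansion in
theorem lemma3p1 {n : ℕ} {M : Type*} [TopologicalSpace M]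
    [ChartedSpace (EuclideanSpace ℝ (Fin n)) M] [IsManifold (𝓡 n) ∞ M]
    (g : PseudoRiemannianMetric n M) (A : StraightNormal g) (k : ℕ) (v w : ℝ)
    (hw : w = -(n + v - 2 * k) / 2)
    (f : ℝ × M × ℝ → ℝ) (hf : f ∈ A.Homogeneous v)
    (u : ℝ × M × ℝ → ℝ) (hu : u ∈ A.Homogeneous w) :
    (∀ q ∈ A.poincareSpace,
      A.ambientOperator k w v f u (StraightNormal.incl q) =
        ∑ i ∈ Finset.range (k + 1), ∑ j ∈ Finset.range (k - i + 1),
          coeffC n k w i j *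
            A.poincareOperator w i
              (fun y => f (StraightNormal.incl y) *
                A.poincareOperator w j (fun z => u (StraightNormal.incl z)) y) q) ∧
    (∀ i j : ℕ, coeffC n k w i j = coeffC n k w j i) ∧
    ((∀ l : ℕ, v ≠ 2 * l) → ∀ i j : ℕ, i + j ≤ k →
      coeffC n k w i j =
        4 ^ (k - i - j) * ((k.factorial : ℝ) / (i.factorial * j.factorial)) *
          (Real.Gamma (n / 2 + w - i) * Real.Gamma (n / 2 + w - j) /
            Real.Gamma (n / 2 + w - k) ^ 2)) := by
  refine ⟨fun q hq => ?_, coeffC_symm n k w, fun hv i j h => coeffC_eq_Gamma hw hv h⟩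
  have hfe := StraightNormal.isExtension_of_homogeneous hf
  have hue := StraightNormal.isExtension_of_homogeneous hu
  let U := A.restrict _ hue.1
  have hU : Set.EqOn (fun z => u (StraightNormal.incl z)) U.1 A.poincareSpace :=
    fun y hy => (A.restrict_apply hue.1 hy).symm
  have hj := fun j => hfe.mul ((hue.congr hU).iterate_lower j)
  let F : ℕ → A.smoothFunctions := fun j => A.restrict _ (hj j).1
  have hF : ∀ j, Set.EqOn (fun y => f (StraightNormal.incl y) *
      A.poincareOperator w j (fun z => u (StraightNormal.incl z)) y) (F j).1 A.poincareSpace := by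
    intro j y hy
    rw [A.restrict_apply (hj j).1 hy]
    exact congrArg (f (StraightNormal.incl y) * ·) (A.poincareOperator_eq hU j hy)
  have hterm : ∀ j ∈ Finset.range (k + 1), coeffA n k w v j *
      A.ambientLaplacian^[k - j] (fun p => f p * A.ambientLaplacian^[j] u p)
        (StraightNormal.incl q) =
      ∑ i ∈ Finset.range (k - j + 1), coeffC n k w i j *
        A.poincareOperator w i (fun y => f (StraightNormal.incl y) *
          A.poincareOperator w j (fun z => u (StraightNormal.incl z)) y) q := by
    intro j hjk
    have hjk' : j ≤ k := Nat.lt_succ_iff.mp (Finset.mem_range.mp hjk)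
    have h : A.IsExtension (v + (w - 2 * j)) _ (F j).1 := (hj j).congr fun y hy => (A.restrict_apply (hj j).1 hy).symm
    -- The relation on weights puts `f Δ̃^j u` at exactly the weight from which `iterate_upper`
    -- starts with `m = k - j`.
    rw [show v + (w - 2 * j) = 2 * (k - j : ℕ) - n - w by rw [Nat.cast_sub hjk', hw]; ring] at h
    have h2 := (StraightNormal.IsExtension.iterate_upper (F := F j) (k - j) h).apply_incl hq
    rw [h2, upperProduct_eq_sum, LinearMap.sum_apply, Submodule.coe_sum, Finset.sum_apply,
      Finset.mul_sum]
    refine Finset.sum_congr rfl fun i hi => ?_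
    have hi' : i + j ≤ k := by
      have := Finset.mem_range.mp hi
      lia
    rw [A.poincareOperator_eq (hF j) i hq, ← coeffA_mul_expansionCoeff hw hi', mul_assoc]
    rfl
  rw [StraightNormal.ambientOperator, Finset.sum_congr rfl hterm]
  -- Both orders of summation run over the triangle `i + j ≤ k`.
  refine Finset.sum_comm' fun i j => ?_
  simp only [Finset.mem_range]
  lia
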